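/- For ordinals we use the von Neumann convention ($\alpha=\{\beta:\beta<\alpha\}$), every ordinal carries its order topology, and cardinals are initial ordinals. An *interval space* is a topological space whose topology is the order topology of some linear ordering of its points. A topological space is a *CO space* if each of its closed subsets is homeomorphic to some clopen subset of it, and it is *scattered* if each nonempty subset has an isolated point in its relative topology. For a cardinal $\lambda$ and $S\subseteq\lambda$, let $L_\alpha$ be the chain $1+\omega^*$ if $\alpha\in S$ and the one-point chain if $\alpha\in\lambda\setminus S$ (where $\omega^*$ is $\omega$ with the reverse order), and let $X_{\lambda,S}$ be the chain $\bigl(\sum_{\alpha<\lambda}L_\alpha\bigr)+1$ with its order topology. Let $\lambda$ be an uncountable regular cardinal, $S\subseteq\lambda$, and let $\vec\mu=\langle\mu_\alpha:\alpha\in S\rangle$ be a family of uncountable regular cardinals; write $\mathrm{Dom}(\vec\mu)=S$ and $\hat\omega=\{-i-1: i\in\omega\}$. The space $X_{\lambda,\vec\mu}$ has as universe the disjoint union $$(\lambda+1)\cup\bigcup_{\alpha\in S}\{\alpha\}\times(\mu_\alpha\cup\hat\omega),$$ and as an open base the sets of the following two kinds: (1) $\{\alpha\}\times U$ and $\{\alpha\}\times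 V$, where $\alpha\in S$, $U\subseteq\mu_\alpha$ is open and $V\subseteq\hat\omega$; (2) the sets $$\Bigl(W\cup\bigcup_{\alpha\in W\cap S}\{\alpha\}\times(\mu_\alpha\cup\hat\omega)\Bigr)\setminus\bigcup_{i\in\sigma}\{i\}\times(F_i\cup G_i),$$ where $W\subseteq\lambda+1$ is open, $\sigma\subseteq W\cap S$ is finite, and for each $i\in\sigma$, $F_i$ is a closed subset of $\mu_i+1$ with $\mu_i\notin F_i$ and $G_i$ is a finite subset of $\hat\omega$. **Proposition.** (a) Let $\lambda$ be an uncountable regular cardinal and let $S_1,S_2\subseteq\lambda$ be such that $S_1\setminus S_2$ is stationary in $\lambda$. Then $X_{\lambda,S_1}$ is not homeomorphic to $X_{\lambda,S_2}$. Also, $X_{\lambda,S_1}$ is not homeomorphic to any ordinal. (b) Let $X$ be a scattered Hausdorff space which is a continuous image of a compact interval space, and assume that $X$ is a CO space. Let $\lambda$ be an uncountable regular cardinal and let $\vec\mu$ be a family of uncountable regular cardinals as above such that $\mathrm{Dom}(\vec\mu)$ is a stationary subset of $\lambda$. Then $X_{\lambda,\vec\mu}$ is not homeomorphic to a subspace of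 $X$. -/

import Mathlib

universe u v w t

namespace COSpaces

open Set Topology Cardinal

/-- `X` is an interval space: its topology is the order topology of some linear order on `X`. -/
def IsIntervalSpace (X : Type v) [TopologicalSpace X] : Prop :=
  ∃ _ : LinearOrder X, OrderTopology X

/-- `X` is a continuous image of a compact interval space (which may live in any universe `w`). -/
def IsImageOfCompactIntervalSpace (X : Type v) [TopologicalSpace X] : Prop :=
  ∃ (L : Type w) (_ : TopologicalSpace L), IsIntervalSpace L ∧ CompactSpace L ∧
    ∃ f : L → X, Continuous f ∧ Function.Surjective f

/-- Every nonempty subset has an isolated point in its relative topology. -/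
def IsScatteredSpace (X : Type v) [TopologicalSpace X] : Prop :=
  ∀ A : Set X, A.Nonempty → ∃ a ∈ A, ∃ U : Set X, IsOpen U ∧ U ∩ A = {a}

/-- Every closed subset is homeomorphic to a clopen subset. -/
def IsCOSpace (X : Type v) [TopologicalSpace X] : Prop :=
  ∀ F : Set X, IsClosed F → ∃ U : Set X, IsClopen U ∧ Nonempty (F ≃ₜ U)

/-- The chain `L_α`: it is `1 + ω^*` (that is, `WithBot ℕᵒᵈ`) if `α ∈ S`, and the one-point chain
`{⊥}` otherwise. -/
abbrev Block {lam : Cardinal.{u}} (S : Set (Iio lam.ord)) (a : Iio lam.ord) : Type :=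
  {x : WithBot ℕᵒᵈ // x = ⊥ ∨ a ∈ S}

/-- The space `X_{λ,S}`: the chain `(∑_{α < λ} L_α) + 1` with its order topology. -/
def SumSpace {lam : Cardinal.{u}} (S : Set (Iio lam.ord)) : Type (u + 1) :=
  WithTop (Σₗ a : Iio lam.ord, Block S a)

noncomputable instance {lam : Cardinal.{u}} (S : Set (Iio lam.ord)) : LinearOrder (SumSpace S) :=
  inferInstanceAs (LinearOrder (WithTop (Σₗ a : Iio lam.ord, Block S a)))

noncomputable instance {lam : Cardinal.{u}} (S : Set (Iio lam.ord)) : TopologicalSpace (SumSpace S) :=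
  Preorder.topology (SumSpace S)

instance {lam : Cardinal.{u}} (S : Set (Iio lam.ord)) : OrderTopology (SumSpace S) := ⟨rfl⟩

/-- The underlying set of `X_{λ,μ}`, where `μ : S → Cardinal` and `S ⊆ λ`: the disjoint union of
`λ + 1` (`spine`) and, for every `α ∈ S`, of `{α} × μ_α` (`arm`) and `{α} × ω̂` (`tail`), where `ω̂`
is a countably infinite set, here indexed by `ℕ` (`n` stands for `-n - 1`). -/
inductive ObstructionSpace {lam : Cardinal.{u}} {S : Set (Iio lam.ord)} (mu : S → Cardinal.{u}) :
    Type (u + 1)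
  | spine (a : Iic lam.ord) : ObstructionSpace mu
  | arm (a : S) (x : Iio (mu a).ord) : ObstructionSpace mu
  | tail (a : S) (n : ℕ) : ObstructionSpace mu

namespace ObstructionSpace

variable {lam : Cardinal.{u}} {S : Set (Iio lam.ord)} (mu : S → Cardinal.{u})

/-- An element of `S ⊆ λ`, seen as an element of `λ + 1`. -/
def base (a : S) : Iic lam.ord := ⟨a.1.1, Iio_subset_Iic_self a.1.2⟩

/-- The set `W ∪ ⋃_{α ∈ W ∩ S} {α} × (μ_α ∪ ω̂) - ⋃_{i ∈ σ} {i} × (F_i ∪ G_i)`. -/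
def tube (W : Set (Iic lam.ord)) (σ : Finset S) (F : (i : S) → Set (Iic (mu i).ord))
    (G : S → Finset ℕ) : Set (ObstructionSpace mu) :=
  {p | match p with
    | spine a => a ∈ W
    | arm a x => base a ∈ W ∧ ¬ (a ∈ σ ∧ (⟨x.1, Iio_subset_Iic_self x.2⟩ : Iic (mu a).ord) ∈ F a)
    | tail a n => base a ∈ W ∧ ¬ (a ∈ σ ∧ n ∈ G a)}

/-- The open base of `X_{λ,μ}`. -/
def openBase : Set (Set (ObstructionSpace mu)) :=
  {B | ∃ (a : S) (U : Set (Iio (mu a).ord)), IsOpen U ∧ B = arm a '' U} ∪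
  {B | ∃ (a : S) (V : Set ℕ), B = tail a '' V} ∪
  {B | ∃ (W : Set (Iic lam.ord)) (σ : Finset S) (F : (i : S) → Set (Iic (mu i).ord))
      (G : S → Finset ℕ), IsOpen W ∧ (∀ i ∈ σ, base i ∈ W) ∧
      (∀ i ∈ σ, IsClosed (F i) ∧ (⟨(mu i).ord, self_mem_Iic⟩ : Iic (mu i).ord) ∉ F i) ∧
      B = tube mu W σ F G}

instance : TopologicalSpace (ObstructionSpace mu) :=
  TopologicalSpace.generateFrom (openBase mu)

end ObstructionSpace

end COSpaces

/-! The invariant behind both parts is a trace modulo the nonstationary ideal. Suppose a point `y`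
has a decreasing neighbourhood basis of closed sets `J a`, indexed by `λ` and continuous at limits.
Two such bases interleave, hence coincide on a club, so the set of limits `a` at which `interior (J
a)` is not closed depends only on `y`, up to a nonstationary set. At the top of `X_{λ,S}` the basis
`[pt a, ⊤]` has trace `S`: the interior at a limit is `(pt a, ⊤]`, and a tail `ω^*` descends to `pt
a` exactly when `a ∈ S`.

For (a), all other points have neighbourhoods of size below `λ`, which regularity of `λ` forbids at
a point with stationary trace. So a homeomorphism preserves the top and its trace. In an ordinal
every trace is also `∅`, because the basis can be replaced by intervals `[c, y]`.

For (b), stationary splitting gives a sequence of subsets `T n` of `S` with `T m \ T n` stationary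
for `m < n`. The compact space `X_{λ,T n}` embeds in `X_{λ,μ}`, so the CO property yields a clopen
copy of it in `X` and therefore a fan point of trace `T n`. Infinitely many traces are impossible
(`IsCOSpace.false_of_isFanPt`). For infinite `M ⊆ ℕ` let `D M` be the set of accumulation points of
the fan points with trace in `M`. Minimising Cantor–Bendixson rank and then cardinality makes the
finite top level of `D N` the same set `E` for all infinite `N` inside some `M`. Split off disjoint
infinite `M₁, M₂ ⊆ M`. Monotone normality, inherited from the linear order, allows isolated points
to be deleted so that all `M₁`-fan points are destroyed and the `M₂`-fan points survive. The closed
set that remains is homeomorphic to a clopen `U`. Counting shows that the finite set `E`, computed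
from `M₂`, lies in `U`; but `E` also consists of accumulation points of `M₁`-fan points, and `U` has
none. -/

namespace COSpaces

open Set Topology Cardinal

/-! ### Clubs, Fodor's lemma and splitting of stationary sets. -/

section RegularOrder

open Order

variable {I : Type v} [LinearOrder I]

theorem exists_isLUB_of_bddAbove [WellFoundedLT I] {s : Set I} (h : BddAbove s) : ∃ a, IsLUB s a := by
  have hne : (upperBounds s).Nonempty := h
  exact ⟨wellFounded_lt.min _ hne, wellFounded_lt.min_mem _ hne,
    fun b hb => not_lt.1 (wellFounded_lt.not_lt_min _ hb)⟩

theorem IsClub.mem_of_limit {C : Set I} (hC : IsClub C) {d : I} (hd : ∃ b, b < d)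
    (h : ∀ b < d, ∃ e ∈ C, b < e ∧ e < d) : d ∈ C := by
  refine hC.isLUB_mem (t := C ∩ Iio d) inter_subset_left ?_ ⟨fun x hx => hx.2.le, fun b hb => ?_⟩
  · obtain ⟨b, hb⟩ := hd
    obtain ⟨e, he, -, h2⟩ := h b hb
    exact ⟨e, he, h2⟩
  · by_contra hlt
    obtain ⟨e, he, h1, h2⟩ := h b (not_le.1 hlt)
    exact absurd (hb ⟨he, h2⟩) (not_le.2 h1)

theorem isClub_of_limit {C : Set I} (hC : IsCofinal C)
    (h : ∀ d, (∃ b, b < d) → (∀ b < d, ∃ e ∈ C, b < e ∧ e < d) → d ∈ C) : IsClub C := by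
  refine ⟨fun t ht hne _ a ha => ?_, hC⟩
  by_cases hat : a ∈ t
  · exact ht hat
  · have hlt : ∀ x ∈ t, x < a := fun x hx => lt_of_le_of_ne (ha.1 hx) fun h => hat (h ▸ hx)
    refine h a (hne.imp hlt) fun b hb => ?_
    obtain ⟨e, he, hbe⟩ := (lt_isLUB_iff ha).1 hb
    exact ⟨e, ht he, hbe, hlt e he⟩

theorem isSuccLimit_iff_exists_between {a : I} :
    IsSuccLimit a ↔ (∃ b, b < a) ∧ ∀ b < a, ∃ c, b < c ∧ c < a := by
  rw [isSuccLimit_iff, not_isMin_iff]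
  refine and_congr_right fun _ => ⟨fun h b hb => ?_, fun h b hb => ?_⟩
  · by_contra! h2
    exact h b ⟨hb, fun c h3 h4 => (h2 c h3).not_gt h4⟩
  · obtain ⟨c, h1, h2⟩ := h b hb.lt
    exact hb.2 h1 h2

variable [WellFoundedLT I] [IsRegularCardinalOrder I]

theorem exists_forall_lt_of_mk_lt {s : Set I} (h : #s < #I) : ∃ b, ∀ x ∈ s, x < b := by
  rw [← cof_eq_cardinalMk (α := I)] at h
  exact not_isCofinal_iff.1 fun hs => (cof_le hs).not_gt h

theorem exists_forall_lt_of_lift_mk_lt {ι : Type w} (f : ι → I)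
    (h : Cardinal.lift.{v} #ι < Cardinal.lift.{w} #I) : ∃ b, ∀ i, f i < b := by
  obtain ⟨b, hb⟩ := exists_forall_lt_of_mk_lt (s := range f)
    (Cardinal.lift_lt.{v, w}.1 (mk_range_le_lift.trans_lt h))
  exact ⟨b, fun i => hb _ ⟨i, rfl⟩⟩

theorem mk_Iio_lt (a : I) : #(Iio a) < #I := by
  have h : Ordinal.typein (α := I) (· < ·) a < Ordinal.type (α := I) (· < ·) :=
    Ordinal.typein_lt_type _ a
  rw [← Cardinal.ord_cardinalMk, Cardinal.lt_ord] at h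
  rwa [Ordinal.card_typein] at h

theorem exists_gt_of_aleph0_lt (hI : ℵ₀ < #I) (a : I) : ∃ b, a < b := by
  obtain ⟨b, hb⟩ := exists_forall_lt_of_mk_lt (s := {a})
    (by simpa using one_lt_aleph0.trans hI)
  exact ⟨b, hb a rfl⟩

theorem cof_ne_aleph0 (hI : ℵ₀ < #I) : cof I ≠ ℵ₀ := by
  rw [cof_eq_cardinalMk]; exact hI.ne'

theorem isClub_Ioi (hI : ℵ₀ < #I) (a : I) : IsClub (Ioi a) := by
  refine isClub_of_limit (fun b => ?_) fun d ⟨b, hb⟩ h => ?_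
  · obtain ⟨c, hc⟩ := exists_gt_of_aleph0_lt hI (max a b)
    exact ⟨c, (le_max_left _ _).trans_lt hc, ((le_max_right _ _).trans_lt hc).le⟩
  · obtain ⟨e, he, -, h2⟩ := h b hb
    exact lt_trans he h2

/-- The diagonal intersection of a family of clubs is a club. -/
theorem isClub_diagonal (hI : ℵ₀ < #I) {C : I → Set I} (hC : ∀ b, IsClub (C b)) :
    IsClub {a | ∀ b < a, a ∈ C b} := by
  refine isClub_of_limit (fun a => ?_) fun d hd h b hb => ?_
  · have step : ∀ x : I, ∃ y, x < y ∧ ∀ b < x, y ∈ C b := by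
      intro x
      have h1 : IsClub (⋂ b : Iio x, C b) := by
        refine IsClub.iInter (cof_ne_aleph0 hI) ?_ fun b => hC b
        rw [cof_eq_cardinalMk]
        simpa using mk_Iio_lt x
      obtain ⟨z, hz⟩ := exists_gt_of_aleph0_lt hI x
      obtain ⟨y, hy, hzy⟩ := h1.isCofinal z
      exact ⟨y, hz.trans_le hzy, fun b hb => mem_iInter.1 hy ⟨b, hb⟩⟩
    choose g hg1 hg2 using step
    -- The supremum of the `ω` iterates of `g` lies in every `C b` with `b` below it, since it is a
    -- limit of points of `C b`.
    have hb : BddAbove (range fun n : ℕ => g^[n] a) := by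
      obtain ⟨b, hb⟩ := exists_forall_lt_of_lift_mk_lt (fun n : ℕ => g^[n] a) (by simpa using hI)
      exact ⟨b, by rintro _ ⟨n, rfl⟩; exact (hb n).le⟩
    obtain ⟨d, hd⟩ := exists_isLUB_of_bddAbove hb
    have hmono : StrictMono fun n : ℕ => g^[n] a :=
      strictMono_nat_of_lt_succ fun n => by
        simp only [Function.iterate_succ_apply']; exact hg1 _
    have hlt : ∀ n : ℕ, g^[n] a < d := fun n => (hmono n.lt_succ_self).trans_le (hd.1 ⟨n + 1, rfl⟩)
    refine ⟨d, fun b hb => ?_, (hlt 0).le⟩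
    obtain ⟨_, ⟨n, rfl⟩, hn⟩ := (lt_isLUB_iff hd).1 hb
    refine IsClub.mem_of_limit (hC b) ⟨b, hb⟩ fun c hc => ?_
    obtain ⟨_, ⟨m, rfl⟩, hm⟩ := (lt_isLUB_iff hd).1 hc
    refine ⟨g^[max n m + 1] a, ?_, ?_, hlt _⟩
    · rw [Function.iterate_succ_apply']
      exact hg2 _ _ (hn.trans_le (hmono.monotone (le_max_left _ _)))
    · exact hm.trans_le (hmono.monotone ((le_max_right n m).trans (Nat.le_succ _)))
  · refine IsClub.mem_of_limit (hC b) hd fun c hc => ?_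
    obtain ⟨e, he, h1, h2⟩ := h (max b c) (max_lt hb hc)
    exact ⟨e, he b ((le_max_left _ _).trans_lt h1), (le_max_right _ _).trans_lt h1, h2⟩

/-- Fodor's pressing down lemma. -/
theorem exists_isStationary_fiber (hI : ℵ₀ < #I) {A : Set I} (hA : IsStationary A) {g : I → I}
    (hg : ∀ a ∈ A, g a < a) : ∃ c, IsStationary {a ∈ A | g a = c} := by
  by_contra! h
  -- Otherwise each fibre misses a club `C c`; a point `a` of `A` in the diagonal intersection lies
  -- in `C (g a)`, yet belongs to the fibre over `g a`.
  simp_rw [not_isStationary_iff] at h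
  choose C hC hd using h
  obtain ⟨a, haA, ha⟩ := hA (isClub_diagonal hI hC)
  exact disjoint_left.1 (hd (g a)) ⟨haA, rfl⟩ (ha _ (hg a haA))

/-- The limit points closed under a function form a club. -/
theorem isClub_closurePoints (hI : ℵ₀ < #I) (g : I → I) (d : I) :
    IsClub {a | IsSuccLimit a ∧ d < a ∧ ∀ b < a, g b < a} := by
  choose f hf using fun b => exists_gt_of_aleph0_lt hI (max b (g b))
  refine isClub_of_limit (fun a => ?_) fun e he h => ?_
  · obtain ⟨x, ⟨hx1, hx2⟩, hx3⟩ := ((isClub_diagonal hI fun b => isClub_Ioi hI (f b)).inter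
      (cof_ne_aleph0 hI) (isClub_Ioi hI d)).isCofinal a
    have h4 : ∀ b < x, f b < x := hx1
    refine ⟨x, ⟨isSuccLimit_iff_exists_between.2 ⟨⟨d, hx2⟩, fun b hb => ⟨f b, ?_, h4 b hb⟩⟩, hx2,
      fun b hb => lt_trans ((le_max_right _ _).trans_lt (hf b)) (h4 b hb)⟩, hx3⟩
    exact (le_max_left _ _).trans_lt (hf b)
  · obtain ⟨b, hb⟩ := he
    obtain ⟨x, ⟨-, h2, -⟩, -, h5⟩ := h b hb
    refine ⟨isSuccLimit_iff_exists_between.2 ⟨⟨b, hb⟩, fun b hb => ?_⟩, h2.trans h5,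
      fun b hb => ?_⟩
    · obtain ⟨x, -, h1⟩ := h b hb
      exact ⟨x, h1⟩
    · obtain ⟨x, ⟨-, -, h2⟩, h3, h4⟩ := h b hb
      exact (h2 b h3).trans h4

/-- Every stationary subset of an uncountable regular cardinal has a stationary subset whose
relative complement is stationary. -/
theorem exists_isStationary_split (hI : ℵ₀ < #I) {A : Set I} (hA : IsStationary A) :
    ∃ B ⊆ A, IsStationary B ∧ IsStationary (A \ B) := by
  -- Without a splitting, every subset of `A` is either nonstationary or has nonstationary
  -- complement in `A`: the club filter on `A` acts as a normal ultrafilter.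
  by_contra! hsplit
  have hI' := cof_ne_aleph0 hI
  have hne : Nonempty I := hA.nonempty.elim fun a _ => ⟨a⟩
  obtain ⟨i₀⟩ := hne
  choose sc hsc using exists_gt_of_aleph0_lt hI
  -- Points `a` below which `A` is not stationary.
  set W : Set I := {a ∈ A | ∃ E : Set I, (∀ b < a, ∃ e ∈ E, b < e ∧ e < a) ∧
    (∀ d < a, (∃ b, b < d) → (∀ b < d, ∃ e ∈ E, b < e ∧ e < d) → d ∈ E) ∧
    ∀ e ∈ E, e < a → IsSuccLimit e → e ∉ A} with hW
  have hWst : IsStationary W := by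
    intro C hC
    set C' : Set I := {d | (∃ b, b < d) ∧ ∀ b < d, ∃ e ∈ C, b < e ∧ e < d} with hC'
    have hC'C : C' ⊆ C := fun d hd => IsClub.mem_of_limit hC hd.1 hd.2
    have hclub : IsClub C' := by
      refine isClub_of_limit (fun a => ?_) fun d hd h => ⟨hd, fun b hb => ?_⟩
      · choose g hg1 hg2 using fun b => hC.isCofinal (sc b)
        obtain ⟨x, ⟨-, hx2, hx3⟩, hax⟩ := (isClub_closurePoints hI g i₀).isCofinal a
        exact ⟨x, ⟨⟨i₀, hx2⟩, fun b hb => ⟨g b, hg1 b, (hsc b).trans_le (hg2 b), hx3 b hb⟩⟩, hax⟩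
      · obtain ⟨e, he, h1, h2⟩ := h b hb
        exact ⟨e, hC'C he, h1, h2⟩
    have hne := hA hclub
    set a := wellFounded_lt.min _ hne with ha
    have haA : a ∈ A ∩ C' := wellFounded_lt.min_mem _ hne
    have hmin : ∀ x < a, x ∈ C' → x ∉ A := fun x hx h1 h2 =>
      wellFounded_lt.not_lt_min (A ∩ C') ⟨h2, h1⟩ hx
    refine ⟨a, ⟨haA.1, ?_⟩, hC'C haA.2⟩
    -- Here `a` is the first point of `A` that is a limit of `C`. If it is a limit of such limits,
    -- `C'` witnesses `a ∈ W`. Otherwise `C` has no limits in some `(b₀, a)`, and the successors of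
    -- its points there form a witness without limit elements.
    by_cases hcof : ∀ b < a, ∃ e ∈ C', b < e ∧ e < a
    · exact ⟨C', hcof, fun d _ hd h => IsClub.mem_of_limit hclub hd h,
        fun e he hea _ => hmin e hea he⟩
    · push Not at hcof
      obtain ⟨b₀, hb₀, hb₀'⟩ := hcof
      refine ⟨{s | ∃ e ∈ C, b₀ < e ∧ e ⋖ s}, fun b hb => ?_, fun d hda hd h => ?_, ?_⟩
      · obtain ⟨e, he, h1, h2⟩ := haA.2.2 (max b b₀) (max_lt hb hb₀)
        obtain ⟨e', -, h1', h2'⟩ := haA.2.2 e h2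
        have hne2 : (Ioi e).Nonempty := ⟨e', h1'⟩
        have hes : e < wellFounded_lt.min _ hne2 := wellFounded_lt.min_mem _ hne2
        have hsm : ∀ x, e < x → wellFounded_lt.min _ hne2 ≤ x :=
          fun x hx => not_lt.1 (wellFounded_lt.not_lt_min (Ioi e) hx)
        exact ⟨_, ⟨e, he, (le_max_right _ _).trans_lt h1, hes, fun c hc => (hsm c hc).not_gt⟩,
          (le_max_left _ _).trans_lt (h1.trans hes), (hsm e' h1').trans_lt h2'⟩
      · have hdC : d ∈ C' := by
          refine ⟨hd, fun b hb => ?_⟩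
          obtain ⟨s, -, h1, h2⟩ := h b hb
          obtain ⟨s', ⟨e, he, -, hes⟩, h1', h2'⟩ := h s h2
          exact ⟨e, he, h1.trans_le (not_lt.1 fun hlt => hes.2 hlt h1'), hes.lt.trans h2'⟩
        obtain ⟨b, hb⟩ := hd
        obtain ⟨s, ⟨e, -, hbe, hes⟩, -, h2⟩ := h b hb
        exact absurd hda (hb₀' d hdC (hbe.trans (hes.lt.trans h2))).not_gt
      · rintro s ⟨e, -, -, hes⟩ - hl
        exact absurd hes (hl.isSuccPrelimit e)
  have hWA : W ⊆ A := fun a ha => ha.1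
  choose! Ef hE1 hE2 hE3 using fun a (ha : a ∈ W) => ha.2
  -- `E` is the limit of the sets `Ef a` along this ultrafilter. By Fodor it agrees with `Ef a`
  -- below `a` for stationarily many `a`, which makes it a club.
  set E : Set I := {x | IsStationary {a ∈ W | x ∈ Ef a}} with hE
  set G : Set I := {a ∈ W | ∀ x < a, x ∈ E ↔ x ∈ Ef a} with hG
  have hGst : IsStationary G := by
    have hu : G ∪ W \ G = W := union_sdiff_cancel fun a ha => ha.1
    rw [← hu, isStationary_union_iff hI'] at hWst
    refine hWst.resolve_right fun hbad => ?_
    have hreg : ∀ a ∈ W \ G, ∃ x < a, ¬ (x ∈ E ↔ x ∈ Ef a) := by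
      rintro a ⟨h1, h2⟩
      by_contra! h3
      exact h2 ⟨h1, h3⟩
    choose! g hg1 hg2 using hreg
    obtain ⟨x, hx⟩ := exists_isStationary_fiber hI hbad hg1
    by_cases hxE : x ∈ E
    · refine hsplit {a ∈ W | x ∈ Ef a} (fun a ha => hWA ha.1) hxE (hx.mono ?_)
      rintro a ⟨ha, rfl⟩
      have := hg2 a ha
      exact ⟨hWA ha.1, fun h => this ⟨fun _ => h.2, fun _ => hxE⟩⟩
    · refine hxE (hx.mono ?_)
      rintro a ⟨ha, rfl⟩
      have := hg2 a ha
      exact ⟨ha.1, by tauto⟩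
  have hGcof : ∀ b, ∃ a ∈ G, b < a := fun b => hGst (isClub_Ioi hI b)
  have hEclub : IsClub E := by
    refine isClub_of_limit (fun b => ?_) fun d hd h => ?_
    · obtain ⟨a, ha, hba⟩ := hGcof b
      obtain ⟨e, he, h1, h2⟩ := hE1 a ha.1 b hba
      exact ⟨e, (ha.2 e h2).2 he, h1.le⟩
    · obtain ⟨a, ha, hda⟩ := hGcof d
      refine (ha.2 d hda).2 (hE2 a ha.1 d hda hd fun b hb => ?_)
      obtain ⟨e, he, h1, h2⟩ := h b hb
      exact ⟨e, (ha.2 e (h2.trans hda)).1 he, h1, h2⟩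
  -- A limit `a ∈ W ∩ E` lies in `Ef a'` for a larger `a' ∈ G`, although `Ef a'` contains no limit
  -- points of `A` below `a'`.
  obtain ⟨a, haW, haE, hlim, -⟩ := hWst (hEclub.inter hI' (isClub_closurePoints hI id i₀))
  obtain ⟨a', ha', haa'⟩ := hGcof a
  exact hE3 a' ha'.1 a ((ha'.2 a haa').1 haE) haa' hlim haW.1

/-- A stationary set has a decreasing sequence of stationary subsets with stationary
differences. -/
theorem exists_stationary_sequence (hI : ℵ₀ < #I) {A : Set I} (hA : IsStationary A) :
    ∃ T : ℕ → Set I, (∀ n, T n ⊆ A) ∧ (∀ n, IsStationary (T n)) ∧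
      ∀ m n, m < n → IsStationary (T m \ T n) := by
  choose f hf1 hf2 hf3 using fun B : {B : Set I // IsStationary B} =>
    exists_isStationary_split hI B.2
  let T : ℕ → {B : Set I // IsStationary B} := fun n => (fun B => ⟨f B, hf2 B⟩)^[n] ⟨A, hA⟩
  have hT : ∀ n, (T (n + 1)).1 = f (T n) := fun n => by
    simp only [T, Function.iterate_succ_apply']
  have hanti : Antitone fun n => (T n).1 :=
    antitone_nat_of_succ_le fun n => by rw [hT]; exact hf1 _
  refine ⟨fun n => (T n).1, fun n => hanti (Nat.zero_le n), fun n => (T n).2, fun m n hmn => ?_⟩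
  refine (hf3 (T m)).mono (sdiff_subset_sdiff_right ?_)
  rw [← hT]
  exact hanti hmn

end RegularOrder

/-! ### Fan bases and their traces modulo the nonstationary ideal. -/

section Fan

open Order

variable {I : Type v} [LinearOrder I] {Y : Type w} [TopologicalSpace Y]

/-- `J` is a decreasing neighbourhood basis of `y` consisting of closed sets, indexed by the
well-order `I` and continuous at limits. -/
structure IsFanBasis (J : I → Set Y) (y : Y) : Prop where
  anti : Antitone J
  mem_nhds : ∀ a, J a ∈ 𝓝 y
  exists_subset : ∀ U ∈ 𝓝 y, ∃ a, J a ⊆ U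
  isClosed : ∀ a, IsClosed (J a)
  mem_of_limit : ∀ a, IsSuccLimit a → ∀ x, (∀ b < a, x ∈ J b) → x ∈ J a

/-- `T` records, up to an initial segment, at which limits the sets `interior (J a)` fail to be
closed. -/
def IsTracePt (T : Set I) (y : Y) : Prop :=
  ∃ J : I → Set Y, IsFanBasis J y ∧
    ∃ d, ∀ a, IsSuccLimit a → d < a → (a ∈ T ↔ ¬ IsClosed (interior (J a)))

/-- A trace point around which the space looks like an end of the chain `∑ L_α + 1`. -/
def IsFanPt (T : Set I) (y : Y) : Prop :=
  ∃ J : I → Set Y, IsFanBasis J y ∧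
    (∃ d, ∀ a, IsSuccLimit a → d < a → (a ∈ T ↔ ¬ IsClosed (interior (J a))) ∧
      ∃ s ∈ J a, IsOpen (J a \ {s}) ∧ ∃ N ∈ 𝓝 s, ∀ z ∈ N, z ∈ J a → z ≠ s → IsOpen {z}) ∧
    ∃ V ∈ 𝓝 y, ∀ a, Cardinal.lift.{v} #(V \ J a : Set Y) < Cardinal.lift.{w} #I

theorem IsFanPt.isTracePt {T : Set I} {y : Y} (h : IsFanPt T y) : IsTracePt T y := by
  obtain ⟨J, hJ, ⟨d, hd⟩, -⟩ := h
  exact ⟨J, hJ, d, fun a h1 h2 => (hd a h1 h2).1⟩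

/-- Discarding an initial segment of a fan basis. -/
theorem IsFanBasis.max {J : I → Set Y} {y : Y} (hJ : IsFanBasis J y) (d : I) :
    IsFanBasis (fun a => J (max a d)) y where
  anti a b hab := hJ.anti (max_le_max_right d hab)
  mem_nhds a := hJ.mem_nhds _
  exists_subset U hU := by
    obtain ⟨a, ha⟩ := hJ.exists_subset U hU
    exact ⟨a, (hJ.anti (le_max_left _ _)).trans ha⟩
  isClosed a := hJ.isClosed _
  mem_of_limit a ha x hx := by
    obtain ⟨⟨b, hb⟩, h2⟩ := isSuccLimit_iff_exists_between.1 ha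
    rcases le_or_gt a d with h | h
    · simpa [max_eq_right h, max_eq_right (hb.le.trans h)] using hx b hb
    · rw [max_eq_left h.le]
      exact hJ.mem_of_limit a ha x fun b hb => hJ.anti (le_max_left _ _) (hx b hb)

theorem isTracePt_empty_of_isOpen_singleton [Nonempty I] [T1Space Y] {y : Y}
    (hy : IsOpen ({y} : Set Y)) : IsTracePt (∅ : Set I) y := by
  inhabit I
  refine ⟨fun _ => {y}, ⟨fun _ _ _ => le_rfl, fun _ => hy.mem_nhds rfl,
    fun U hU => ⟨default, singleton_subset_iff.2 (mem_of_mem_nhds hU)⟩, fun _ => isClosed_singleton,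
    fun a ha x hx => ?_⟩, default, fun a _ _ => ?_⟩
  · obtain ⟨⟨b, hb⟩, -⟩ := isSuccLimit_iff_exists_between.1 ha
    exact hx b hb
  · simp [hy.interior_eq]

theorem IsFanPt.exists_isOpen [T1Space Y] {T : Set I} {y : Y} (h : IsFanPt T y) :
    ∃ V : Set Y, IsOpen V ∧ y ∈ V ∧ ∀ z ∈ V, z ≠ y →
      ∃ N ∈ 𝓝 z, Cardinal.lift.{v} #N < Cardinal.lift.{w} #I := by
  obtain ⟨J, hJ, -, V, hV, hc⟩ := h
  refine ⟨interior V, isOpen_interior, mem_interior_iff_mem_nhds.2 hV, fun z hz hzy => ?_⟩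
  obtain ⟨a, ha⟩ := hJ.exists_subset {z}ᶜ (isOpen_compl_singleton.mem_nhds (Ne.symm hzy))
  exact ⟨V \ J a, Filter.inter_mem (mem_interior_iff_mem_nhds.1 hz)
    ((hJ.isClosed a).isOpen_compl.mem_nhds fun h => ha h rfl), hc a⟩

variable [WellFoundedLT I] [IsRegularCardinalOrder I]

/-- Each basis refines the other. At a limit closed under both refinement functions, continuity of
the bases forces `J a = J' a`. -/
theorem IsTracePt.exists_isClub (hI : ℵ₀ < #I) {T T' : Set I} {y : Y} (h : IsTracePt T y)
    (h' : IsTracePt T' y) : ∃ C, IsClub C ∧ ∀ a ∈ C, a ∈ T ↔ a ∈ T' := by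
  obtain ⟨J, hJ, d, hd⟩ := h
  obtain ⟨J', hJ', d', hd'⟩ := h'
  choose g hg using fun b => hJ.exists_subset _ (hJ'.mem_nhds b)
  choose g' hg' using fun b => hJ'.exists_subset _ (hJ.mem_nhds b)
  refine ⟨_, isClub_closurePoints hI (fun b => max (g b) (g' b)) (max d d'), ?_⟩
  rintro a ⟨hlim, hda, ha⟩
  have hJJ' : J a = J' a := by
    refine Subset.antisymm (fun x hx => hJ'.mem_of_limit a hlim x fun b hb => hg b ?_)
      fun x hx => hJ.mem_of_limit a hlim x fun b hb => hg' b ?_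
    · exact hJ.anti ((le_max_left _ _).trans (ha b hb).le) hx
    · exact hJ'.anti ((le_max_right _ _).trans (ha b hb).le) hx
  rw [hd a hlim ((le_max_left _ _).trans_lt hda), hd' a hlim ((le_max_right _ _).trans_lt hda),
    hJJ']

theorem IsTracePt.not_isStationary_diff (hI : ℵ₀ < #I) {T T' : Set I} {y : Y} (h : IsTracePt T y)
    (h' : IsTracePt T' y) : ¬ IsStationary (T \ T') := by
  obtain ⟨C, hC, hTT'⟩ := h.exists_isClub hI h'
  intro hst
  obtain ⟨a, ha, haC⟩ := hst hC
  exact ha.2 ((hTT' a haC).1 ha.1)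

theorem IsTracePt.not_isOpen_singleton [T1Space Y] (hI : ℵ₀ < #I) {T : Set I} {y : Y}
    (h : IsTracePt T y) (hT : IsStationary T) : ¬ IsOpen ({y} : Set Y) := by
  intro hy
  have : Nonempty I := hT.nonempty.elim fun a _ => ⟨a⟩
  refine h.not_isStationary_diff hI (isTracePt_empty_of_isOpen_singleton hy) ?_
  simpa using hT

/-- Every point of `N` other than `y` leaves the basis at some stage. By regularity these fewer than
`#I` stages are bounded, so some `J b` is contained in `{y}`. -/
theorem IsFanBasis.isOpen_singleton_of_mk_lt [T1Space Y] {J : I → Set Y} {y : Y}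
    (hJ : IsFanBasis J y) {N : Set Y} (hN : N ∈ 𝓝 y)
    (hc : Cardinal.lift.{v} #N < Cardinal.lift.{w} #I) : IsOpen ({y} : Set Y) := by
  obtain ⟨a₀, ha₀⟩ := hJ.exists_subset N hN
  have h1 : ∀ z : N, ∃ a, z.1 ≠ y → z.1 ∉ J a := by
    intro z
    by_cases hz : z.1 = y
    · exact ⟨a₀, fun h => absurd hz h⟩
    · obtain ⟨a, ha⟩ := hJ.exists_subset {z.1}ᶜ (isOpen_compl_singleton.mem_nhds (Ne.symm hz))
      exact ⟨a, fun _ h => ha h rfl⟩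
  choose f hf using h1
  obtain ⟨b, hb⟩ := exists_forall_lt_of_lift_mk_lt f hc
  have hsub : J (Max.max a₀ b) ⊆ {y} := by
    intro z hz
    by_contra hzy
    have hzN : z ∈ N := ha₀ (hJ.anti (le_max_left _ _) hz)
    exact hf ⟨z, hzN⟩ hzy (hJ.anti ((hb ⟨z, hzN⟩).le.trans (le_max_right _ _)) hz)
  have := Filter.mem_of_superset (hJ.mem_nhds _) hsub
  exact isOpen_singleton_iff_nhds_eq_pure y |>.2
    (le_antisymm (by simpa using this) (pure_le_nhds y))

theorem IsTracePt.not_mk_lt [T1Space Y] (hI : ℵ₀ < #I) {T : Set I} {y : Y}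
    (h : IsTracePt T y) (hT : IsStationary T) {N : Set Y} (hN : N ∈ 𝓝 y) :
    ¬ Cardinal.lift.{v} #N < Cardinal.lift.{w} #I := by
  intro hc
  refine h.not_isOpen_singleton hI hT ?_
  obtain ⟨J, hJ, -⟩ := h
  exact hJ.isOpen_singleton_of_mk_lt hN hc

end Fan

universe x

theorem lift_mk_lt_of_subset_image {I : Type v} {A : Type w} {B : Type x} {f : A → B} {s : Set B} {t : Set A} (h : s ⊆ f '' t)
    (hc : Cardinal.lift.{v} #t < Cardinal.lift.{w} #I) :
    Cardinal.lift.{v} #s < Cardinal.lift.{x} #I := by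
  rw [← Cardinal.lift_lt.{max v x, w}]
  have h1 : Cardinal.lift.{w} #s ≤ Cardinal.lift.{x} #t :=
    (Cardinal.lift_le.2 (mk_le_mk_of_subset h)).trans mk_image_le_lift
  have h2 := Cardinal.lift_le.{v}.2 h1
  have h3 := Cardinal.lift_lt.{max v w, x}.2 hc
  simp only [Cardinal.lift_lift] at h2 h3 ⊢
  exact lt_of_le_of_lt h2 h3

/-! ### Invariance of fan points under local homeomorphisms. -/

section Transfer

open Order

variable {I : Type v} [LinearOrder I] {A : Type w} {B : Type x} [TopologicalSpace A]
  [TopologicalSpace B]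

theorem isClosed_image_of_mapsTo (e : OpenPartialHomeomorph A B) {C : Set B} (hC : IsClosed C)
    (hCt : C ⊆ e.target) {K : Set A} (hK : K ⊆ e.source) (hKC : MapsTo e K C) (hcl : IsClosed K) :
    IsClosed (e '' K) := by
  have h : e '' K = C ∩ e.symm ⁻¹' K := by
    ext b
    constructor
    · rintro ⟨a, ha, rfl⟩
      exact ⟨hKC ha, by simpa [e.left_inv (hK ha)] using ha⟩
    · rintro ⟨h1, h2⟩
      exact ⟨e.symm b, h2, e.right_inv (hCt h1)⟩
  rw [h]
  exact (e.continuousOn_symm.mono hCt).preimage_isClosed_of_isClosed hC hcl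

theorem interior_image_of_subset_source (e : OpenPartialHomeomorph A B) {K : Set A}
    (hK : K ⊆ e.source) : interior (e '' K) = e '' interior K := by
  refine Subset.antisymm (fun b hb => ?_) (interior_maximal (image_mono interior_subset)
    (e.isOpen_image_of_subset_source isOpen_interior (interior_subset.trans hK)))
  obtain ⟨a, ha, rfl⟩ := interior_subset hb
  refine ⟨a, ?_, rfl⟩
  have hopen : IsOpen (e.source ∩ e ⁻¹' interior (e '' K)) :=
    e.isOpen_inter_preimage isOpen_interior
  refine interior_maximal ?_ hopen ⟨hK ha, hb⟩
  rintro x ⟨hx, hx'⟩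
  obtain ⟨z, hz, hzx⟩ := interior_subset hx'
  rwa [← e.injOn (hK hz) hx hzx]

/-- Being a fan point is a local property. -/
theorem IsFanPt.map [RegularSpace B] (e : OpenPartialHomeomorph A B) {T : Set I}
    {a : A} (ha : a ∈ e.source) (h : IsFanPt T a) : IsFanPt T (e a) := by
  obtain ⟨J, hJ, ⟨d, hd⟩, V, hV, hc⟩ := h
  -- Closedness in the source need not survive in `B`; confining the images to a closed `C` inside
  -- the target guarantees it.
  obtain ⟨C, hC, hCcl, hCt⟩ :=
    exists_mem_nhds_isClosed_subset (e.open_target.mem_nhds (e.map_source ha))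
  have hCa : e.source ∩ e ⁻¹' C ∈ 𝓝 a :=
    Filter.inter_mem (e.open_source.mem_nhds ha) ((e.continuousAt ha) hC)
  obtain ⟨i, hi⟩ := hJ.exists_subset _ hCa
  have hJ' := hJ.max i
  have hsub : ∀ b, J (max b i) ⊆ e.source ∩ e ⁻¹' C := fun b =>
    (hJ.anti (le_max_right _ _)).trans hi
  have hsrc : ∀ b, J (max b i) ⊆ e.source := fun b => (hsub b).trans inter_subset_left
  have hmaps : ∀ b, MapsTo e (J (max b i)) C := fun b x hx => (hsub b hx).2
  refine ⟨fun b => e '' J (max b i), ⟨fun b c hbc => image_mono (hJ'.anti hbc),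
    fun b => e.image_mem_nhds ha (hJ'.mem_nhds b), fun U hU => ?_, fun b =>
    isClosed_image_of_mapsTo e hCcl hCt (hsrc b) (hmaps b) (hJ'.isClosed b), fun b hb x hx => ?_⟩,
    ⟨max d i, fun b hb hdb => ?_⟩, e '' (V ∩ e.source), ?_, fun b => ?_⟩
  · obtain ⟨b, hb⟩ := hJ'.exists_subset _ ((e.continuousAt ha) hU)
    exact ⟨b, image_subset_iff.2 hb⟩
  · obtain ⟨⟨c, hc⟩, -⟩ := isSuccLimit_iff_exists_between.1 hb
    obtain ⟨z, hz, rfl⟩ := hx c hc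
    refine ⟨z, hJ'.mem_of_limit b hb z fun c' hc' => ?_, rfl⟩
    obtain ⟨z', hz', h⟩ := hx c' hc'
    rwa [← e.injOn (hsrc _ hz') (hsrc _ hz) h]
  · have hib : max b i = b := max_eq_left ((le_max_right _ _).trans hdb.le)
    obtain ⟨h1, s, hs, hso, N, hN, hNi⟩ := hd b hb ((le_max_left _ _).trans_lt hdb)
    have hsrc' := hsrc b
    have hmaps' := hmaps b
    simp only [hib] at hsrc' hmaps' ⊢
    refine ⟨?_, e s, mem_image_of_mem e hs, ?_, e '' (N ∩ e.source), ?_, ?_⟩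
    · rw [h1, interior_image_of_subset_source e hsrc', not_iff_not]
      have hint : interior (J b) ⊆ e.source := interior_subset.trans hsrc'
      refine ⟨isClosed_image_of_mapsTo e hCcl hCt hint
        (hmaps'.mono_left interior_subset), fun h => ?_⟩
      have himg : e.symm '' (e '' interior (J b)) = interior (J b) :=
        e.symm_image_image_of_subset_source hint
      rw [← himg]
      refine isClosed_image_of_mapsTo e.symm (hJ.isClosed b) hsrc' ?_ ?_ h
      · exact image_subset_iff.2 fun x hx => e.map_source (hint hx)
      · rw [mapsTo_iff_image_subset, himg]
        exact interior_subset
    · have : e '' J b \ {e s} = e '' (J b \ {s}) := by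
        ext x
        constructor
        · rintro ⟨⟨z, hz, rfl⟩, hne⟩
          exact ⟨z, ⟨hz, fun h => hne (congrArg e h)⟩, rfl⟩
        · rintro ⟨z, ⟨hz, hne⟩, rfl⟩
          exact ⟨⟨z, hz, rfl⟩, fun h => hne (e.injOn (hsrc' hz) (hsrc' hs) h)⟩
      rw [this]
      exact e.isOpen_image_of_subset_source hso (sdiff_subset.trans hsrc')
    · exact e.image_mem_nhds (hsrc' hs) (Filter.inter_mem hN (e.open_source.mem_nhds (hsrc' hs)))
    · rintro _ ⟨z, ⟨hzN, hzs⟩, rfl⟩ ⟨z', hz', h⟩ hne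
      obtain rfl := e.injOn (hsrc' hz') hzs h
      have := e.isOpen_image_of_subset_source (hNi z' hzN hz' fun h => hne (congrArg e h))
        (singleton_subset_iff.2 hzs)
      simpa using this
  · exact e.image_mem_nhds ha (Filter.inter_mem hV (e.open_source.mem_nhds ha))
  · have hss : (e '' (V ∩ e.source) \ e '' J (max b i) : Set B) ⊆ e '' (V \ J (max b i)) := by
      rintro _ ⟨⟨z, hz, rfl⟩, hz'⟩
      exact ⟨z, ⟨hz.1, fun h => hz' ⟨z, h, rfl⟩⟩, rfl⟩
    exact lift_mk_lt_of_subset_image hss (hc (max b i))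

theorem isFanPt_iff_of_isOpenEmbedding [RegularSpace A] [RegularSpace B] {j : A → B}
    (hj : IsOpenEmbedding j) {T : Set I} {a : A} : IsFanPt T (j a) ↔ IsFanPt T a := by
  have : Nonempty A := ⟨a⟩
  refine ⟨fun h => ?_, fun h => ?_⟩
  · have := h.map (hj.toOpenPartialHomeomorph j).symm (by simp)
    have h2 := (hj.toOpenPartialHomeomorph j).left_inv (x := a) (by simp)
    rw [hj.toOpenPartialHomeomorph_apply j] at h2
    rwa [h2] at this
  · exact h.map (hj.toOpenPartialHomeomorph j) (by simp)

end Transfer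

/-! ### Compactness of complete linear orders. -/

section CompactOrder

theorem compactSpace_of_exists_isLUB {α : Type v} [LinearOrder α] [TopologicalSpace α]
    [OrderTopology α] (h : ∀ s : Set α, ∃ a, IsLUB s a) : CompactSpace α := by
  refine ⟨isCompact_iff_ultrafilter_le_nhds.2 fun f _ => ?_⟩
  -- The limit of the ultrafilter is the supremum of the points whose final segments belong to it.
  obtain ⟨a, ha⟩ := h {x | Ici x ∈ f}
  refine ⟨a, mem_univ a, ?_⟩
  rw [nhds_eq_order]
  refine le_inf (le_iInf₂ fun b hb => ?_) (le_iInf₂ fun b hb => ?_)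
  · obtain ⟨x, hx, hbx⟩ := (lt_isLUB_iff ha).1 hb
    exact Filter.le_principal_iff.2 (Filter.mem_of_superset hx fun y hy => lt_of_lt_of_le hbx hy)
  · have : Ici b ∉ f := fun hbf => (ha.1 hbf).not_gt hb
    rw [← Ultrafilter.compl_mem_iff_notMem, compl_Ici] at this
    exact Filter.le_principal_iff.2 this

end CompactOrder

/-! ### The chain `∑ L_α + 1`: order, compactness, and the trace of its top. -/

section SumSpace

open Order

variable {lam : Cardinal.{u}}

theorem mk_Iio_ord : #(Iio lam.ord) = Cardinal.lift.{u + 1} lam := by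
  rw [Cardinal.mk_Iio_ordinal, card_ord]

theorem aleph0_lt_mk_Iio_ord (h : ℵ₀ < lam) : ℵ₀ < #(Iio lam.ord) := by
  rw [mk_Iio_ord]
  simpa using h

theorem isRegularCardinalOrder_Iio_ord (h : lam.IsRegular) :
    IsRegularCardinalOrder (Iio lam.ord) where
  type_lt_le_ord_cof := by
    have h1 : Order.cof (Iio lam.ord) = Cardinal.lift.{u + 1} lam := by
      rw [Ordinal.cof_Iio, ← Ordinal.lift_cof, h.cof_ord]
    rw [h1, ← Cardinal.lift_ord, ← Ordinal.typein_ordinal]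
    rfl

variable (S : Set (Iio lam.ord))

/-- The least point of the block `L_a`. -/
def pt (a : Iio lam.ord) : SumSpace S :=
  ((toLex ⟨a, ⟨⊥, Or.inl rfl⟩⟩ : Σₗ a : Iio lam.ord, Block S a) : WithTop _)

/-- The points of the part `ω^*` of the block `L_a`. -/
def tl (a : S) (n : ℕ) : SumSpace S :=
  ((toLex ⟨a, ⟨((OrderDual.toDual n : ℕᵒᵈ) : WithBot ℕᵒᵈ), Or.inr a.2⟩⟩ :
    Σₗ a : Iio lam.ord, Block S a) : WithTop _)

instance : OrderTop (SumSpace S) :=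
  inferInstanceAs (OrderTop (WithTop (Σₗ a : Iio lam.ord, Block S a)))

variable {S}

theorem SumSpace.cases {motive : SumSpace S → Prop} (top : motive ⊤)
    (pt : ∀ a, motive (pt S a)) (tl : ∀ a n, motive (tl S a n)) (x : SumSpace S) : motive x := by
  match x with
  | none => exact top
  | some ⟨a, ⟨none, h⟩⟩ => exact pt a
  | some ⟨a, ⟨some n, h⟩⟩ =>
    have ha : a ∈ S := h.resolve_left (by rintro ⟨⟩)
    exact tl ⟨a, ha⟩ n

theorem lex_lt_iff {a b : Iio lam.ord} {p : Block S a} {q : Block S b} :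
    (toLex ⟨a, p⟩ : Σₗ a : Iio lam.ord, Block S a) < toLex ⟨b, q⟩ ↔
      a < b ∨ a = b ∧ p.1 < q.1 := by
  constructor
  · rintro (⟨_, _, h⟩ | ⟨_, _, h⟩)
    · exact Or.inl h
    · exact Or.inr ⟨rfl, h⟩
  · rintro (h | ⟨rfl, h⟩)
    · exact Sigma.Lex.left _ _ h
    · exact Sigma.Lex.right _ _ h

theorem pt_lt_top (a : Iio lam.ord) : pt S a < ⊤ := WithTop.coe_lt_top _

theorem tl_lt_top (a : S) (n : ℕ) : tl S a n < ⊤ := WithTop.coe_lt_top _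

theorem pt_lt_pt {a b : Iio lam.ord} : pt S a < pt S b ↔ a < b := by
  refine WithTop.coe_lt_coe.trans (lex_lt_iff.trans ?_)
  simp

theorem pt_lt_tl {a : Iio lam.ord} {b : S} {n : ℕ} : pt S a < tl S b n ↔ a ≤ b := by
  refine WithTop.coe_lt_coe.trans (lex_lt_iff.trans ?_)
  simp [WithBot.bot_lt_coe, le_iff_lt_or_eq]

theorem tl_lt_pt {a : S} {b : Iio lam.ord} {n : ℕ} : tl S a n < pt S b ↔ a < b := by
  refine WithTop.coe_lt_coe.trans (lex_lt_iff.trans ?_)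
  simp

theorem tl_lt_tl {a b : S} {m n : ℕ} : tl S a m < tl S b n ↔ a < b ∨ a = b ∧ n < m := by
  refine WithTop.coe_lt_coe.trans (lex_lt_iff.trans ?_)
  simp [Subtype.ext_iff]

theorem exists_covBy_Iio_ord (h : ℵ₀ ≤ lam) (a : Iio lam.ord) : ∃ b : Iio lam.ord, a ⋖ b := by
  have hs : Order.succ a.1 < lam.ord := (Cardinal.isSuccLimit_ord h).succ_lt a.2
  refine ⟨⟨Order.succ a.1, hs⟩, Order.lt_succ a.1, fun c hc hc' => ?_⟩
  exact absurd (Order.succ_le_of_lt (show a.1 < c.1 from hc)) (not_le.2 hc')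

theorem pt_strictMono : StrictMono (pt S) := fun _ _ h => pt_lt_pt.2 h

theorem pt_le_pt {a b : Iio lam.ord} : pt S a ≤ pt S b ↔ a ≤ b := pt_strictMono.le_iff_le

theorem pt_le_tl {a : Iio lam.ord} {b : S} {n : ℕ} : pt S a ≤ tl S b n ↔ a ≤ b := by
  rw [← not_lt, tl_lt_pt, not_lt]

theorem tl_le_tl {a b : S} {m n : ℕ} : tl S a m ≤ tl S b n ↔ a < b ∨ a = b ∧ n ≤ m := by
  rw [← not_lt, tl_lt_tl]
  rcases lt_trichotomy a b with h | h | h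
  · simp [h, h.not_gt, h.ne']
  · simp [h]
  · simp [h, h.not_gt, h.ne']

theorem exists_lt_pt (h : ℵ₀ ≤ lam) {x : SumSpace S} (hx : x < ⊤) : ∃ a, x < pt S a := by
  induction x using SumSpace.cases with
  | top => exact absurd hx (lt_irrefl _)
  | pt a =>
    obtain ⟨b, hb⟩ := exists_covBy_Iio_ord h a
    exact ⟨b, pt_lt_pt.2 hb.lt⟩
  | tl a n =>
    obtain ⟨b, hb⟩ := exists_covBy_Iio_ord h a.1
    exact ⟨b, tl_lt_pt.2 hb.lt⟩

theorem eq_tl_of_mem_Ioo {a b : Iio lam.ord} (hab : a ⋖ b) {x : SumSpace S} (h1 : pt S a < x)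
    (h2 : x < pt S b) : ∃ (h : a ∈ S) (n : ℕ), x = tl S ⟨a, h⟩ n := by
  induction x using SumSpace.cases with
  | top => exact absurd h2 not_top_lt
  | pt c => exact absurd (pt_lt_pt.1 h2) (hab.2 (pt_lt_pt.1 h1))
  | tl c n =>
    obtain ⟨c, hc⟩ := c
    obtain rfl : a = c := le_antisymm (pt_lt_tl.1 h1) (hab.le_of_lt (tl_lt_pt.1 h2))
    exact ⟨hc, n, rfl⟩

theorem exists_forall_lt_pt {a : Iio lam.ord} {x : SumSpace S} (hx : x < pt S a) :
    ∃ b < a, ∀ c, b < c → x < pt S c := by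
  induction x using SumSpace.cases with
  | top => exact absurd hx not_top_lt
  | pt b => exact ⟨b, pt_lt_pt.1 hx, fun c hc => pt_lt_pt.2 hc⟩
  | tl b n => exact ⟨b, tl_lt_pt.1 hx, fun c hc => tl_lt_pt.2 hc⟩

theorem Ioi_tl_zero {a b : Iio lam.ord} (ha : a ∈ S) (hab : a ⋖ b) :
    Ioi (tl S ⟨a, ha⟩ 0) = Ici (pt S b) := by
  ext x
  simp only [mem_Ioi, mem_Ici]
  induction x using SumSpace.cases with
  | top => simp [tl_lt_top]
  | pt c => rw [tl_lt_pt, pt_le_pt]; exact hab.lt_iff_le_right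
  | tl c n =>
    rw [tl_lt_tl, pt_le_tl]
    simp only [Nat.not_lt_zero, and_false, or_false]
    exact hab.lt_iff_le_right

theorem Ioi_pt {a b : Iio lam.ord} (ha : a ∉ S) (hab : a ⋖ b) :
    Ioi (pt S a) = Ici (pt S b) := by
  ext x
  simp only [mem_Ioi, mem_Ici]
  refine ⟨fun h => ?_, (pt_lt_pt.2 hab.lt).trans_le⟩
  by_contra hlt
  obtain ⟨h, -⟩ := eq_tl_of_mem_Ioo hab h (not_le.1 hlt)
  exact ha h

/-- At a successor `b`, the point `pt b` has an immediate predecessor: `tl a 0` if `a ∈ S`, and `pt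
a` otherwise. -/
theorem isOpen_Ici_pt {a b : Iio lam.ord} (hab : a ⋖ b) : IsOpen (Ici (pt S b)) := by
  by_cases ha : a ∈ S
  · rw [← Ioi_tl_zero ha hab]; exact isOpen_Ioi
  · rw [← Ioi_pt ha hab]; exact isOpen_Ioi

theorem isOpen_singleton_tl (h : ℵ₀ ≤ lam) (a : S) (n : ℕ) : IsOpen ({tl S a n} : Set _) := by
  obtain ⟨b, hb⟩ := exists_covBy_Iio_ord h a.1
  -- Tails are reversed, so `tl (n + 1)` is the neighbour below and `tl (n - 1)` the one above;
  -- above `tl 0` comes the next block.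
  have hsplit : ({tl S a n} : Set _) = Ioi (tl S a (n + 1)) ∩
      (if n = 0 then Iio (pt S b) else Iio (tl S a (n - 1))) := by
    ext x
    simp only [mem_singleton_iff, mem_inter_iff, mem_Ioi]
    constructor
    · rintro rfl
      refine ⟨tl_lt_tl.2 (Or.inr ⟨rfl, Nat.lt_succ_self n⟩), ?_⟩
      split_ifs with hn
      · exact tl_lt_pt.2 hb.lt
      · exact tl_lt_tl.2 (Or.inr ⟨rfl, by omega⟩)
    · rintro ⟨h1, h2⟩
      have h3 : x < pt S b := by
        split_ifs at h2 with hn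
        · exact h2
        · exact lt_trans h2 (tl_lt_pt.2 hb.lt)
      obtain ⟨ha, m, rfl⟩ := eq_tl_of_mem_Ioo hb ((pt_lt_tl.2 le_rfl).trans h1) h3
      have h1' := tl_lt_tl.1 h1
      have h4 : m ≤ n := by
        rcases h1' with h | h
        · exact absurd h (lt_irrefl _)
        · omega
      have h5 : n ≤ m := by
        split_ifs at h2 with hn
        · omega
        · rcases tl_lt_tl.1 h2 with h | h
          · exact absurd h (lt_irrefl _)
          · omega
      rw [le_antisymm h4 h5]
  rw [hsplit]
  refine isOpen_Ioi.inter ?_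
  split_ifs
  · exact isOpen_Iio
  · exact isOpen_Iio

theorem interior_Ici_pt {a : Iio lam.ord} (ha : IsSuccLimit a) :
    interior (Ici (pt S a)) = Ioi (pt S a) := by
  obtain ⟨⟨b, hb⟩, hlim⟩ := isSuccLimit_iff_exists_between.1 ha
  refine Subset.antisymm (fun x hx => ?_) (interior_maximal Ioi_subset_Ici_self isOpen_Ioi)
  refine lt_of_le_of_ne (interior_subset hx) ?_
  rintro rfl
  obtain ⟨l, hl, hsub⟩ := exists_Ioc_subset_of_mem_nhds (mem_interior_iff_mem_nhds.1 hx)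
    ⟨pt S b, pt_lt_pt.2 hb⟩
  obtain ⟨c, hca, hc⟩ := exists_forall_lt_pt hl
  obtain ⟨e, hce, hea⟩ := hlim c hca
  have := hsub ⟨hc e hce, (pt_lt_pt.2 hea).le⟩
  exact hea.not_ge (pt_le_pt.1 this)

/-- The interior is `Ioi (pt S a)`. It is a closed ray when the block is a single point, whereas a
tail `ω^*` accumulates at the omitted `pt S a`. -/
theorem isClosed_interior_Ici_pt_iff (h : ℵ₀ ≤ lam) {a : Iio lam.ord} (ha : IsSuccLimit a) :
    IsClosed (interior (Ici (pt S a))) ↔ a ∉ S := by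
  obtain ⟨b, hab⟩ := exists_covBy_Iio_ord h a
  rw [interior_Ici_pt ha]
  refine ⟨fun hcl haS => ?_, fun haS => by rw [Ioi_pt haS hab]; exact isClosed_Ici⟩
  have hmem : pt S a ∈ closure (Ioi (pt S a)) := by
    rw [mem_closure_iff_nhds]
    intro t ht
    obtain ⟨u, hu, hsub⟩ := exists_Ico_subset_of_mem_nhds ht ⟨⊤, pt_lt_top a⟩
    have : ∃ n, tl S ⟨a, haS⟩ n < u := by
      induction u using SumSpace.cases with
      | top => exact ⟨0, tl_lt_top _ _⟩
      | pt c => exact ⟨0, tl_lt_pt.2 (pt_lt_pt.1 hu)⟩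
      | tl c n =>
        refine ⟨n + 1, tl_lt_tl.2 ?_⟩
        rcases (pt_lt_tl.1 hu).lt_or_eq with h | h
        · exact Or.inl h
        · exact Or.inr ⟨Subtype.ext h, Nat.lt_succ_self n⟩
    obtain ⟨n, hn⟩ := this
    have hlt : pt S a < tl S ⟨a, haS⟩ n := pt_lt_tl.2 le_rfl
    exact ⟨_, hsub ⟨hlt.le, hn⟩, hlt⟩
  rw [hcl.closure_eq] at hmem
  exact (mem_Ioi.1 hmem).false

theorem mk_Iio_pt_lt (hreg : lam.IsRegular) (h : ℵ₀ < lam) (a : Iio lam.ord) :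
    #(Iio (pt S a)) < #(Iio lam.ord) := by
  have := isRegularCardinalOrder_Iio_ord hreg
  have hI := aleph0_lt_mk_Iio_ord h
  classical
  -- `none` codes the first point of a block and `some n` its tail; the value `pt S b` for `b ∉ S`
  -- is a dummy.
  let f : Iio a × Option ℕ → SumSpace S := fun p => match p with
    | (b, none) => pt S b
    | (b, some n) => if hb : b.1 ∈ S then tl S ⟨b.1, hb⟩ n else pt S b
  have hsub : Iio (pt S a) ⊆ range f := by
    intro x hx
    induction x using SumSpace.cases with
    | top => exact absurd (mem_Iio.1 hx) not_top_lt
    | pt b => exact ⟨(⟨b, pt_lt_pt.1 hx⟩, none), rfl⟩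
    | tl b n => exact ⟨(⟨b, tl_lt_pt.1 hx⟩, some n), by simp [f]⟩
  refine (mk_le_mk_of_subset hsub).trans_lt (mk_range_le.trans_lt ?_)
  rw [mk_prod]
  refine mul_lt_of_lt hI.le ?_ ?_
  · simpa using mk_Iio_lt a
  · simpa using hI

/-- The largest point of `X_{λ,S}` is a fan point with trace `S`. -/
theorem isFanPt_top (hreg : lam.IsRegular) (h : ℵ₀ < lam) : IsFanPt S (⊤ : SumSpace S) := by
  have hne : (0 : Ordinal) < lam.ord := hreg.ord_pos
  refine ⟨fun a => Ici (pt S a), ⟨fun a b hab => Ici_subset_Ici.2 (pt_le_pt.2 hab),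
    fun a => Ici_mem_nhds (pt_lt_top a), fun U hU => ?_, fun a => isClosed_Ici,
    fun a ha x hx => ?_⟩, ⟨⟨0, hne⟩, fun a ha _ => ⟨?_, pt S a, self_mem_Ici, ?_, ?_⟩⟩,
    univ, Filter.univ_mem, fun a => ?_⟩
  · obtain ⟨l, hl, hsub⟩ := exists_Ioc_subset_of_mem_nhds hU ⟨_, pt_lt_top ⟨0, hne⟩⟩
    obtain ⟨a, ha⟩ := exists_lt_pt h.le hl
    exact ⟨a, fun x hx => hsub ⟨ha.trans_le hx, le_top⟩⟩
  · by_contra hlt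
    obtain ⟨b, hb, hb'⟩ := exists_forall_lt_pt (not_le.1 hlt)
    obtain ⟨c, hbc, hca⟩ := (isSuccLimit_iff_exists_between.1 ha).2 b hb
    exact (hb' c hbc).not_ge (hx c hca)
  · rw [isClosed_interior_Ici_pt_iff h.le ha, not_not]
  · rw [Ici_sdiff_left]; exact isOpen_Ioi
  · obtain ⟨b, hab⟩ := exists_covBy_Iio_ord h.le a
    refine ⟨Iio (pt S b), Iio_mem_nhds (pt_lt_pt.2 hab.lt), fun z hz hza hne => ?_⟩
    obtain ⟨h1, n, rfl⟩ := eq_tl_of_mem_Ioo hab (lt_of_le_of_ne hza (Ne.symm hne)) hz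
    exact isOpen_singleton_tl h.le _ _
  · rw [← compl_eq_univ_sdiff, compl_Ici]
    simpa using mk_Iio_pt_lt hreg h a

theorem eq_top_of_isTracePt (hreg : lam.IsRegular) (h : ℵ₀ < lam) {T : Set (Iio lam.ord)}
    (hT : IsStationary T) {x : SumSpace S} (hx : IsTracePt T x) : x = ⊤ := by
  have := isRegularCardinalOrder_Iio_ord hreg
  by_contra hne
  obtain ⟨a, ha⟩ := exists_lt_pt h.le (lt_top_iff_ne_top.2 hne)
  refine hx.not_mk_lt (aleph0_lt_mk_Iio_ord h) hT (Iio_mem_nhds ha) ?_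
  simpa using mk_Iio_pt_lt hreg h a

theorem exists_isLUB_sumSpace (h : ℵ₀ ≤ lam) (s : Set (SumSpace S)) : ∃ x, IsLUB s x := by
  by_cases hb : ∃ a, pt S a ∈ upperBounds s
  · -- the least block whose first point is an upper bound
    have hne : {a | pt S a ∈ upperBounds s}.Nonempty := hb
    set a := wellFounded_lt.min _ hne with ha
    have hau : pt S a ∈ upperBounds s := wellFounded_lt.min_mem _ hne
    have hmin : ∀ c < a, pt S c ∉ upperBounds s := fun c hc h' =>
      wellFounded_lt.not_lt_min {a | pt S a ∈ upperBounds s} h' hc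
    by_cases hlub : ∀ y ∈ upperBounds s, pt S a ≤ y
    · exact ⟨_, hau, hlub⟩
    push Not at hlub
    obtain ⟨y, hy, hya⟩ := hlub
    -- then `y` is a point of the tail of a block
    induction y using SumSpace.cases with
    | top => exact absurd hya not_top_lt
    | pt c => exact absurd hy (hmin c (pt_lt_pt.1 hya))
    | tl c n =>
      have hca : c.1 < a := tl_lt_pt.1 hya
      have hex := hmin c.1 hca
      simp only [mem_upperBounds, not_forall, not_le] at hex
      obtain ⟨z, hz, hcz⟩ := hex
      obtain ⟨b, hcb⟩ := exists_covBy_Iio_ord h c.1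
      have htail : ∀ w, pt S c.1 < w → w ≤ tl S c n → ∃ m, w = tl S c m := by
        intro w h1 h2
        obtain ⟨hc, m, hm⟩ := eq_tl_of_mem_Ioo hcb h1 (h2.trans_lt (tl_lt_pt.2 hcb.lt))
        exact ⟨m, hm⟩
      have hne' : ∃ m, tl S c m ∈ s := by
        obtain ⟨m, rfl⟩ := htail z hcz (hy hz)
        exact ⟨m, hz⟩
      classical
      -- The least index in the reversed tail gives the maximum of `s`.
      refine ⟨tl S c (Nat.find hne'), fun w hw => ?_, fun w hw => hw (Nat.find_spec hne')⟩
      rcases le_or_gt w (pt S c.1) with h1 | h1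
      · exact h1.trans (pt_le_tl.2 le_rfl)
      · obtain ⟨m, rfl⟩ := htail w h1 (hy hw)
        exact tl_le_tl.2 (Or.inr ⟨rfl, Nat.find_min' hne' hw⟩)
  · refine ⟨⊤, fun x _ => le_top, fun y hy => ?_⟩
    by_contra hlt
    obtain ⟨a, ha⟩ := exists_lt_pt h (not_le.1 hlt)
    exact hb ⟨a, fun x hx => (hy hx).trans ha.le⟩

theorem compactSpace_sumSpace (h : ℵ₀ ≤ lam) : CompactSpace (SumSpace S) :=
  compactSpace_of_exists_isLUB (exists_isLUB_sumSpace h)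

theorem isEmpty_homeomorph_sumSpace (hreg : lam.IsRegular) (h : ℵ₀ < lam)
    {S₁ S₂ : Set (Iio lam.ord)} (hS : IsStationary (S₁ \ S₂)) :
    IsEmpty (SumSpace S₁ ≃ₜ SumSpace S₂) := by
  have := isRegularCardinalOrder_Iio_ord hreg
  refine ⟨fun e => ?_⟩
  have h1 : IsTracePt S₁ (e ⊤) :=
    ((isFanPt_iff_of_isOpenEmbedding e.isOpenEmbedding).2 (isFanPt_top hreg h)).isTracePt
  have h2 := eq_top_of_isTracePt hreg h (hS.mono sdiff_subset) h1
  rw [h2] at h1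
  exact h1.not_isStationary_diff (aleph0_lt_mk_Iio_ord h) (isFanPt_top hreg h).isTracePt hS

end SumSpace

/-! ### Traces in well-ordered spaces. -/

section WellOrdered

open Order

variable {Y : Type w} [LinearOrder Y] [WellFoundedLT Y] [TopologicalSpace Y] [OrderTopology Y]

theorem isOpen_Iic_of_wellFoundedLT (y : Y) : IsOpen (Iic y) := by
  by_cases h : (Ioi y).Nonempty
  · have h1 : y < wellFounded_lt.min _ h := wellFounded_lt.min_mem _ h
    have : Iic y = Iio (wellFounded_lt.min _ h) := by
      ext z
      refine ⟨fun hz => lt_of_le_of_lt hz h1, fun hz => ?_⟩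
      by_contra hlt
      exact wellFounded_lt.not_lt_min (Ioi y) (not_le.1 hlt) hz
    rw [this]
    exact isOpen_Iio
  · have : Iic y = Set.univ := by
      ext z
      simpa using not_lt.1 fun hz => h ⟨z, hz⟩
    rw [this]
    exact isOpen_univ

/-- Replace `J a` by the longest interval `[c a, y]` inside it. Continuity of `J` passes to these
intervals, and their interiors are `[c a, y]` or `(c a, y]`, both closed because initial segments
`Iic` are open. -/
theorem isTracePt_empty_of_wellFoundedLT {I : Type v} [LinearOrder I] {T : Set I} {y : Y}
    (h : IsTracePt T y) : IsTracePt (∅ : Set I) y := by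
  obtain ⟨J, hJ, d, -⟩ := h
  have hne : ∀ a, {c | c ≤ y ∧ Icc c y ⊆ J a}.Nonempty := fun a =>
    ⟨y, le_rfl, by simpa using mem_of_mem_nhds (hJ.mem_nhds a)⟩
  set c : I → Y := fun a => wellFounded_lt.min _ (hne a) with hc
  have hcy : ∀ a, c a ≤ y := fun a => (wellFounded_lt.min_mem _ (hne a)).1
  have hcJ : ∀ a, Icc (c a) y ⊆ J a := fun a => (wellFounded_lt.min_mem _ (hne a)).2
  have hcmin : ∀ a z, z ≤ y → Icc z y ⊆ J a → c a ≤ z := fun a z h1 h2 =>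
    not_lt.1 (wellFounded_lt.not_lt_min {c | c ≤ y ∧ Icc c y ⊆ J a} ⟨h1, h2⟩)
  have hIic : Iic y ∈ 𝓝 y := (isOpen_Iic_of_wellFoundedLT y).mem_nhds self_mem_Iic
  refine ⟨fun a => Icc (c a) y, ⟨fun a b hab => Icc_subset_Icc_left
    (hcmin a _ (hcy b) ((hcJ b).trans (hJ.anti hab))), fun a => ?_, fun U hU => ?_,
    fun a => isClosed_Icc, fun a ha x hx => ⟨?_, ?_⟩⟩, d, fun a _ _ => ?_⟩
  · by_cases hl : ∃ l, l < y
    · obtain ⟨l, hl, hsub⟩ := exists_Ioc_subset_of_mem_nhds (hJ.mem_nhds a) hl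
      refine Filter.mem_of_superset (Filter.inter_mem (Ioi_mem_nhds hl) hIic) ?_
      rintro z ⟨hlz, hzy⟩
      exact ⟨hcmin a z hzy fun x hx => hsub ⟨lt_of_lt_of_le hlz hx.1, hx.2⟩, hzy⟩
    · refine Filter.mem_of_superset hIic fun z hz => ⟨(hcy a).trans ?_, hz⟩
      exact not_lt.1 fun h => hl ⟨z, h⟩
  · obtain ⟨a, ha⟩ := hJ.exists_subset U hU
    exact ⟨a, (hcJ a).trans ha⟩
  · obtain ⟨⟨b, hb⟩, -⟩ := isSuccLimit_iff_exists_between.1 ha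
    refine hcmin a x (hx b hb).2 fun z hz => hJ.mem_of_limit a ha z fun b' hb' => ?_
    exact hcJ b' ⟨(hx b' hb').1.trans hz.1, hz.2⟩
  · obtain ⟨⟨b, hb⟩, -⟩ := isSuccLimit_iff_exists_between.1 ha
    exact (hx b hb).2
  · simp only [mem_empty_iff_false, false_iff, not_not]
    have hIoc : Ioc (c a) y ⊆ interior (Icc (c a) y) :=
      interior_maximal Ioc_subset_Icc_self
        (isOpen_Ioi.inter (isOpen_Iic_of_wellFoundedLT y))
    by_cases hmem : c a ∈ interior (Icc (c a) y)
    · have : interior (Icc (c a) y) = Icc (c a) y := by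
        refine Subset.antisymm interior_subset fun z hz => ?_
        rcases hz.1.eq_or_lt with h | h
        · rwa [← h]
        · exact hIoc ⟨h, hz.2⟩
      rw [this]
      exact isClosed_Icc
    · have : interior (Icc (c a) y) = Ioc (c a) y := by
        refine Subset.antisymm (fun z hz => ?_) hIoc
        refine ⟨lt_of_le_of_ne (interior_subset hz).1 ?_, (interior_subset hz).2⟩
        rintro rfl
        exact hmem hz
      rw [this, ← isOpen_compl_iff]
      have : (Ioc (c a) y)ᶜ = Iic (c a) ∪ Ioi y := by
        ext z
        simp only [mem_compl_iff, mem_Ioc, not_and_or, not_lt, not_le, mem_union, mem_Iic, mem_Ioi]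
      rw [this]
      exact (isOpen_Iic_of_wellFoundedLT _).union isOpen_Ioi

end WellOrdered

/-! ### The ordinal case, and `X_{λ,T}` inside `X_{λ,μ}`. -/

section Embedding

open Order ObstructionSpace

variable {lam : Cardinal.{u}}

theorem isEmpty_homeomorph_ordinal (hreg : lam.IsRegular) (h : ℵ₀ < lam)
    {S : Set (Iio lam.ord)} (hS : IsStationary S) (β : Ordinal.{t}) :
    IsEmpty (SumSpace S ≃ₜ Iio β) := by
  have := isRegularCardinalOrder_Iio_ord hreg
  refine ⟨fun e => ?_⟩
  have h1 : IsTracePt S (e ⊤) :=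
    ((isFanPt_iff_of_isOpenEmbedding e.isOpenEmbedding).2 (isFanPt_top hreg h)).isTracePt
  refine h1.not_isStationary_diff (aleph0_lt_mk_Iio_ord h) (isTracePt_empty_of_wellFoundedLT h1) ?_
  simpa using hS

variable {S T : Set (Iio lam.ord)} {mu : S → Cardinal.{u}}

/-- The embedding of `X_{λ,T}` into `X_{λ,μ}` for `T ⊆ Dom μ`. -/
noncomputable def toObstruction (mu : S → Cardinal.{u}) (hTS : T ⊆ S) : SumSpace T → ObstructionSpace mu
  | none => spine ⟨lam.ord, self_mem_Iic⟩
  | some ⟨a, ⟨none, _⟩⟩ => spine ⟨a.1, Iio_subset_Iic_self a.2⟩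
  | some ⟨a, ⟨some n, h⟩⟩ => tail ⟨a, hTS (h.resolve_left (by rintro ⟨⟩))⟩ n

theorem toObstruction_top (hTS : T ⊆ S) :
    toObstruction mu hTS ⊤ = spine ⟨lam.ord, self_mem_Iic⟩ := rfl

theorem toObstruction_pt (hTS : T ⊆ S) (a : Iio lam.ord) :
    toObstruction mu hTS (pt T a) = spine ⟨a.1, Iio_subset_Iic_self a.2⟩ := rfl

theorem toObstruction_tl (hTS : T ⊆ S) (a : T) (n : ℕ) :
    toObstruction mu hTS (tl T a n) = tail ⟨a.1, hTS a.2⟩ n := rfl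

theorem toObstruction_injective (hTS : T ⊆ S) : Function.Injective (toObstruction mu hTS) := by
  intro x y hxy
  induction x using SumSpace.cases with
  | top =>
    induction y using SumSpace.cases with
    | top => rfl
    | pt b =>
      rw [toObstruction_top, toObstruction_pt] at hxy
      simp only [spine.injEq, Subtype.mk.injEq] at hxy
      exact absurd b.2 (by simp [← hxy])
    | tl b n => cases hxy
  | pt a =>
    induction y using SumSpace.cases with
    | top =>
      rw [toObstruction_top, toObstruction_pt] at hxy
      simp only [spine.injEq, Subtype.mk.injEq] at hxy
      exact absurd a.2 (by simp [hxy])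
    | pt b =>
      rw [toObstruction_pt, toObstruction_pt] at hxy
      simp only [spine.injEq, Subtype.mk.injEq] at hxy
      rw [Subtype.ext hxy]
    | tl b n => cases hxy
  | tl a n =>
    induction y using SumSpace.cases with
    | top => cases hxy
    | pt b => cases hxy
    | tl b m =>
      rw [toObstruction_tl, toObstruction_tl] at hxy
      simp only [tail.injEq, Subtype.mk.injEq] at hxy
      rw [Subtype.ext hxy.1, hxy.2]

/-- The projection of `X_{λ,T}` onto `λ + 1`. -/
noncomputable def toSpine : SumSpace T → Iic lam.ord
  | none => ⟨lam.ord, self_mem_Iic⟩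
  | some ⟨a, _⟩ => ⟨a.1, Iio_subset_Iic_self a.2⟩

theorem continuous_toSpine (h : ℵ₀ ≤ lam) : Continuous (toSpine (T := T)) := by
  rw [OrderTopology.continuous_iff]
  rintro ⟨c, hc'⟩
  rcases (mem_Iic.1 hc').lt_or_eq with hc | rfl
  · obtain ⟨b, hb⟩ := exists_covBy_Iio_ord h ⟨c, hc⟩
    refine ⟨?_, ?_⟩
    · convert isOpen_Ici_pt (S := T) hb using 1
      ext x
      rw [mem_preimage, mem_Ioi, mem_Ici]
      induction x using SumSpace.cases with
      | top => exact iff_of_true hc le_top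
      | pt a => exact (hb.lt_iff_le_right (z := a)).trans pt_le_pt.symm
      | tl a n => exact (hb.lt_iff_le_right (z := a.1)).trans pt_le_tl.symm
    · convert isOpen_Iio (a := pt T ⟨c, hc⟩) using 1
      ext x
      rw [mem_preimage, mem_Iio, mem_Iio]
      induction x using SumSpace.cases with
      | top => exact iff_of_false hc.not_gt not_top_lt
      | pt a => exact (pt_lt_pt (S := T) (a := a) (b := ⟨c, hc⟩)).symm
      | tl a n => exact (tl_lt_pt (S := T) (a := a) (b := ⟨c, hc⟩) (n := n)).symm
  · refine ⟨?_, ?_⟩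
    · convert isOpen_empty
      ext x
      exact iff_of_false (fun hx => absurd (mem_Iic.1 (toSpine x).2) (not_le.2 hx)) id
    · convert isOpen_Iio (a := (⊤ : SumSpace T)) using 1
      ext x
      rw [mem_preimage, mem_Iio, mem_Iio]
      induction x using SumSpace.cases with
      | top => exact iff_of_false (lt_irrefl (lam.ord)) (lt_irrefl _)
      | pt a => exact iff_of_true a.2 (pt_lt_top a)
      | tl a n => exact iff_of_true a.1.2 (tl_lt_top a n)

/-- Arms are missed by the map and tail points are isolated in the source. A tube pulls back to the
preimage of `W` under `toSpine`, with finitely many tail points removed. -/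
theorem continuous_toObstruction (h : ℵ₀ ≤ lam) (hTS : T ⊆ S) :
    Continuous (toObstruction mu hTS) := by
  refine continuous_generateFrom_iff.2 ?_
  rintro B ((⟨a, U, -, rfl⟩ | ⟨a, V, rfl⟩) | ⟨W, σ, F, G, hW, -, -, rfl⟩)
  · convert isOpen_empty
    ext x
    refine iff_of_false ?_ id
    rintro ⟨y, -, hy⟩
    induction x using SumSpace.cases with
    | top => cases hy
    | pt b => cases hy
    | tl b n => cases hy
  · rw [isOpen_iff_forall_mem_open]
    rintro x ⟨n, hn, hx⟩
    induction x using SumSpace.cases with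
    | top => cases hx
    | pt b => cases hx
    | tl b m =>
      refine ⟨{tl T b m}, ?_, isOpen_singleton_tl h b m, rfl⟩
      rintro _ rfl
      exact ⟨n, hn, hx⟩
  · classical
    have hfin : (⋃ a ∈ σ, ⋃ n ∈ G a, {x | toObstruction mu hTS x = tail a n}).Finite := by
      refine σ.finite_toSet.biUnion fun a _ => (G a).finite_toSet.biUnion fun n _ => ?_
      exact (finite_singleton (tail a n)).preimage (toObstruction_injective hTS).injOn
    convert (hW.preimage (continuous_toSpine (T := T) h)).sdiff hfin.isClosed using 1
    ext x
    simp only [mem_sdiff, mem_iUnion, mem_ofPred_eq, exists_prop, mem_preimage]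
    induction x using SumSpace.cases with
    | top =>
      refine ⟨fun hx => ⟨hx, ?_⟩, fun hx => hx.1⟩
      rintro ⟨a, -, n, -, h⟩
      cases h
    | pt b =>
      refine ⟨fun hx => ⟨hx, ?_⟩, fun hx => hx.1⟩
      rintro ⟨a, -, n, -, h⟩
      cases h
    | tl b m =>
      refine ⟨fun hx => ⟨hx.1, ?_⟩, fun hx => ⟨hx.1, fun h => hx.2 ⟨_, h.1, m, h.2, rfl⟩⟩⟩
      rintro ⟨a, ha, n, hn, h⟩
      cases h
      exact hx.2 ⟨ha, hn⟩

end Embedding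

/-! ### Monotone normality of continuous images of compact interval spaces. -/

section MonotoneNormality

/-- A monotone normality operator on a topological space. -/
structure IsMonotoneNormality {X : Type v} [TopologicalSpace X] (G : X → Set X → Set X) :
    Prop where
  mem_nhds : ∀ x U, IsOpen U → x ∈ U → G x U ∈ 𝓝 x
  subset : ∀ x U, IsOpen U → x ∈ U → G x U ⊆ U
  mem_or_mem : ∀ x U y V, IsOpen U → x ∈ U → IsOpen V → y ∈ V →
    (G x U ∩ G y V).Nonempty → x ∈ V ∨ y ∈ U

/-- Linearly ordered spaces are monotonically normal. -/
theorem exists_isMonotoneNormality_of_orderTopology (L : Type v) [LinearOrder L]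
    [TopologicalSpace L] [OrderTopology L] :
    ∃ G : L → Set L → Set L, IsMonotoneNormality G := by
  let r : L → L → Prop := WellOrderingRel
  have hwf : WellFounded r := WellOrderingRel.isWellOrder.wf
  let R : L → Set L → Set L := fun p U => {x | p < x ∧ Icc p x ⊆ U}
  let R' : L → Set L → Set L := fun p U => {x | x < p ∧ Icc x p ⊆ U}
  -- On each side of `p`, the neighbourhood ends at the `r`-least point reachable from `p` inside
  -- `U`, so that endpoints are chosen coherently for different `p` and `U`.
  let G : L → Set L → Set L := fun p U => {q | q = p ∨
    (∃ e ∈ R p U, (∀ x ∈ R p U, ¬ r x e) ∧ p < q ∧ q < e) ∨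
    (∃ e ∈ R' p U, (∀ x ∈ R' p U, ¬ r x e) ∧ e < q ∧ q < p)}
  have hsub : ∀ p U, p ∈ U → G p U ⊆ U := by
    rintro p U hp q (rfl | ⟨e, he, -, h1, h2⟩ | ⟨e, he, -, h1, h2⟩)
    · exact hp
    · exact he.2 ⟨h1.le, h2.le⟩
    · exact he.2 ⟨h1.le, h2.le⟩
  refine ⟨G, ⟨fun p U hU hp => ?_, fun p U _ hp => hsub p U hp, ?_⟩⟩
  · have hright : ∃ A ∈ 𝓝 p, ∀ q ∈ A, p < q → q ∈ G p U := by
      by_cases hne : (R p U).Nonempty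
      · have he := hwf.min_mem _ hne
        exact ⟨Iio (hwf.min _ hne), Iio_mem_nhds he.1, fun q hq hpq =>
          Or.inr (Or.inl ⟨_, he, fun x hx => hwf.not_lt_min _ hx, hpq, hq⟩)⟩
      · by_cases hmax : ∃ u, p < u
        · obtain ⟨u, hu, hsub⟩ := exists_Ico_subset_of_mem_nhds (hU.mem_nhds hp) hmax
          refine ⟨Iio u, Iio_mem_nhds hu, fun q hq hpq => absurd ⟨q, hpq, ?_⟩ hne⟩
          exact fun x hx => hsub ⟨hx.1, lt_of_le_of_lt hx.2 hq⟩
        · exact ⟨Set.univ, Filter.univ_mem, fun q _ hpq => absurd ⟨q, hpq⟩ hmax⟩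
    have hleft : ∃ A ∈ 𝓝 p, ∀ q ∈ A, q < p → q ∈ G p U := by
      by_cases hne : (R' p U).Nonempty
      · have he := hwf.min_mem _ hne
        exact ⟨Ioi (hwf.min _ hne), Ioi_mem_nhds he.1, fun q hq hpq =>
          Or.inr (Or.inr ⟨_, he, fun x hx => hwf.not_lt_min _ hx, hq, hpq⟩)⟩
      · by_cases hmin : ∃ u, u < p
        · obtain ⟨u, hu, hsub⟩ := exists_Ioc_subset_of_mem_nhds (hU.mem_nhds hp) hmin
          refine ⟨Ioi u, Ioi_mem_nhds hu, fun q hq hpq => absurd ⟨q, hpq, ?_⟩ hne⟩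
          exact fun x hx => hsub ⟨lt_of_lt_of_le hq hx.1, hx.2⟩
        · exact ⟨Set.univ, Filter.univ_mem, fun q _ hpq => absurd ⟨q, hpq⟩ hmin⟩
    obtain ⟨A, hA, hA'⟩ := hright
    obtain ⟨B, hB, hB'⟩ := hleft
    refine Filter.mem_of_superset (Filter.inter_mem hA hB) fun q hq => ?_
    rcases lt_trichotomy q p with h | h | h
    · exact hB' q hq.2 h
    · exact Or.inl h
    · exact hA' q hq.1 h
  · have key : ∀ p U q V, p ∈ U → q ∈ V → p < q → (G p U ∩ G q V).Nonempty → p ∈ V ∨ q ∈ U := by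
      rintro p U q V hp hq hpq ⟨z, hz, hz'⟩
      by_contra! hcon
      obtain ⟨hpV, hqU⟩ := hcon
      rcases hz with rfl | ⟨e, he, hemin, h1, h2⟩ | ⟨e, he, hemin, h1, h2⟩
      · exact hpV (hsub q V hq hz')
      · rcases hz' with rfl | ⟨e', he', hemin', h1', h2'⟩ | ⟨e', he', hemin', h1', h2'⟩
        · exact hqU (he.2 ⟨h1.le, h2.le⟩)
        · exact hqU (he.2 ⟨hpq.le, (h1'.trans h2).le⟩)
        -- The endpoints satisfy `p < e' < e < q`, so each was a candidate for the other choice;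
        -- `r`-minimality of both would force `e = e'`.
        · have heq : e < q := not_le.1 fun h => hqU (he.2 ⟨hpq.le, h⟩)
          have hpe' : p < e' := not_le.1 fun h => hpV (he'.2 ⟨h, hpq.le⟩)
          have hlt : e' < e := h1'.trans h2
          have h3 := hemin e' ⟨hpe', (Icc_subset_Icc_right hlt.le).trans he.2⟩
          have h4 := hemin' e ⟨heq, (Icc_subset_Icc_left hlt.le).trans he'.2⟩
          rcases WellOrderingRel.isWellOrder.toTrichotomous.rel_or_eq_or_rel_swap (a := e)
            (b := e') with h | h | h
          · exact h4 h
          · exact hlt.ne' h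
          · exact h3 h
      · have hzq : z < q := h2.trans hpq
        rcases hz' with rfl | ⟨e', he', hemin', h1', h2'⟩ | ⟨e', he', hemin', h1', h2'⟩
        · exact lt_irrefl _ hzq
        · exact lt_irrefl _ (hzq.trans h1')
        · exact hpV (he'.2 ⟨(h1'.trans h2).le, hpq.le⟩)
    intro p U q V _ hp _ hq hne
    rcases lt_trichotomy p q with h | rfl | h
    · exact key p U q V hp hq h hne
    · exact Or.inl hq
    · rw [inter_comm] at hne
      exact (key q V p U hq hp h hne).symm

/-- Monotone normality passes to images under closed maps. -/
theorem IsMonotoneNormality.exists_of_isClosedMap {L : Type w} {X : Type v} [TopologicalSpace L]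
    [TopologicalSpace X] {G : L → Set L → Set L} (hG : IsMonotoneNormality G) {f : L → X}
    (hf : Continuous f) (hcl : IsClosedMap f) (hsurj : Function.Surjective f) :
    ∃ H : X → Set X → Set X, IsMonotoneNormality H := by
  -- The operator downstairs consists of the points whose whole fibre lies in `O x U`; closedness of
  -- `f` makes this set open.
  let O : X → Set X → Set L := fun x U => ⋃ p ∈ f ⁻¹' {x}, interior (G p (f ⁻¹' U))
  have hOo : ∀ x U, IsOpen (O x U) := fun x U => isOpen_biUnion fun _ _ => isOpen_interior
  have hH : ∀ x U l, f l ∈ (f '' (O x U)ᶜ)ᶜ → l ∈ O x U := fun x U l hl => by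
    by_contra h
    exact hl ⟨l, h, rfl⟩
  refine ⟨fun x U => (f '' (O x U)ᶜ)ᶜ, ⟨fun x U hU hx => ?_, fun x U hU hx y hy => ?_, ?_⟩⟩
  · refine (hcl _ (hOo x U).isClosed_compl).isOpen_compl.mem_nhds ?_
    rintro ⟨l, hl, rfl⟩
    refine hl (mem_biUnion rfl (mem_interior_iff_mem_nhds.2 ?_))
    exact hG.mem_nhds _ _ (hU.preimage hf) hx
  · obtain ⟨l, rfl⟩ := hsurj y
    obtain ⟨p, rfl, hp'⟩ := mem_iUnion₂.1 (hH x U l hy)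
    exact hG.subset p _ (hU.preimage hf) hx (interior_subset hp')
  · rintro x U y V hU hx hV hy ⟨z, hz, hz'⟩
    obtain ⟨l, rfl⟩ := hsurj z
    obtain ⟨p, rfl, hp⟩ := mem_iUnion₂.1 (hH x U l hz)
    obtain ⟨q, rfl, hq⟩ := mem_iUnion₂.1 (hH y V l hz')
    exact hG.mem_or_mem p (f ⁻¹' U) q (f ⁻¹' V) (hU.preimage hf) hx (hV.preimage hf) hy
      ⟨l, interior_subset hp, interior_subset hq⟩

theorem IsImageOfCompactIntervalSpace.exists_isMonotoneNormality {X : Type v} [TopologicalSpace X]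
    [T2Space X] (h : IsImageOfCompactIntervalSpace.{v, w} X) :
    CompactSpace X ∧ ∃ G : X → Set X → Set X, IsMonotoneNormality G := by
  obtain ⟨L, _, ⟨_, _⟩, _, f, hf, hsurj⟩ := h
  obtain ⟨G, hG⟩ := exists_isMonotoneNormality_of_orderTopology L
  exact ⟨hsurj.compactSpace hf, hG.exists_of_isClosedMap hf hf.isClosedMap hsurj⟩

/-- In a monotonically normal space, a relatively discrete set `P` has a family of neighbourhoods
such that each point outside the closure of `P` has a neighbourhood meeting at most one of them. -/
theorem IsMonotoneNormality.exists_expansion {X : Type v} [TopologicalSpace X] [RegularSpace X]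
    {G : X → Set X → Set X} (hG : IsMonotoneNormality G) {P : Set X} {U : X → Set X}
    (hU : ∀ y ∈ P, IsOpen (U y) ∧ y ∈ U y ∧ ∀ z ∈ U y, z ∈ P → z = y) :
    ∃ V : X → Set X, (∀ y ∈ P, IsOpen (V y) ∧ y ∈ V y ∧ closure (V y) ⊆ U y) ∧
      ∀ x ∉ closure P, ∃ N ∈ 𝓝 x, ∀ y ∈ P, ∀ z ∈ P, (N ∩ V y).Nonempty → (N ∩ V z).Nonempty →
        y = z := by
  have hmem : ∀ y ∈ P, y ∈ interior (G y (U y)) := fun y hy =>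
    mem_interior_iff_mem_nhds.2 (hG.mem_nhds y _ (hU y hy).1 (hU y hy).2.1)
  have hdisj : ∀ y ∈ P, ∀ z ∈ P, (interior (G y (U y)) ∩ interior (G z (U z))).Nonempty →
      y = z := by
    rintro y hy z hz ⟨x, hx, hx'⟩
    rcases hG.mem_or_mem y _ z _ (hU y hy).1 (hU y hy).2.1 (hU z hz).1 (hU z hz).2.1
      ⟨x, interior_subset hx, interior_subset hx'⟩ with h | h
    · exact (hU z hz).2.2 y h hy
    · exact ((hU y hy).2.2 z h hz).symm
  -- Applying `G` twice matters: if a neighbourhood of `x` meets the inner set, then `x` lies in the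
  -- outer set, and the outer sets are pairwise disjoint.
  have hex : ∀ y, ∃ V : Set X, y ∈ P → IsOpen V ∧ y ∈ V ∧ closure V ⊆ U y ∧
      V ⊆ G y (interior (G y (U y))) := by
    intro y
    by_cases hy : y ∈ P
    · obtain ⟨C, hC, hCcl, hCsub⟩ := exists_mem_nhds_isClosed_subset (Filter.inter_mem
        (hG.mem_nhds y _ isOpen_interior (hmem y hy)) ((hU y hy).1.mem_nhds (hU y hy).2.1))
      refine ⟨interior C, fun _ => ⟨isOpen_interior, mem_interior_iff_mem_nhds.2 hC, ?_, ?_⟩⟩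
      · exact (closure_minimal interior_subset hCcl).trans (hCsub.trans inter_subset_right)
      · exact interior_subset.trans (hCsub.trans inter_subset_left)
    · exact ⟨∅, fun h => absurd h hy⟩
  choose V hV using hex
  refine ⟨V, fun y hy => ⟨(hV y hy).1, (hV y hy).2.1, (hV y hy).2.2.1⟩, fun x hx => ?_⟩
  refine ⟨_, hG.mem_nhds x _ isClosed_closure.isOpen_compl hx, ?_⟩
  have key : ∀ y ∈ P, (G x (closure P)ᶜ ∩ V y).Nonempty → x ∈ interior (G y (U y)) := by
    rintro y hy ⟨z, hz, hz'⟩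
    rcases hG.mem_or_mem x _ y _ isClosed_closure.isOpen_compl hx isOpen_interior (hmem y hy)
      ⟨z, hz, (hV y hy).2.2.2 hz'⟩ with h | h
    · exact h
    · exact absurd (subset_closure hy) h
  exact fun y hy z hz h1 h2 => hdisj y hy z hz ⟨x, key y hy h1, key z hz h2⟩

end MonotoneNormality

/-! ### Cantor–Bendixson derivatives in compact scattered spaces. -/

section CantorBendixson

variable {X : Type v} [TopologicalSpace X]

/-- The iterated Cantor–Bendixson derivatives of a set. -/
def cbDeriv (A : Set X) (o : Ordinal.{v}) : Set X :=
  A ∩ ⋂ i : Iio o, derivedSet (cbDeriv A i.1)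
termination_by o
decreasing_by exact i.2

theorem mem_cbDeriv {A : Set X} {o : Ordinal.{v}} {x : X} :
    x ∈ cbDeriv A o ↔ x ∈ A ∧ ∀ i < o, x ∈ derivedSet (cbDeriv A i) := by
  rw [cbDeriv]
  simp

theorem cbDeriv_antitone (A : Set X) : Antitone (cbDeriv A) := fun _ _ h _ hx =>
  mem_cbDeriv.2 ⟨(mem_cbDeriv.1 hx).1, fun i hi => (mem_cbDeriv.1 hx).2 i (hi.trans_le h)⟩

theorem cbDeriv_mono {A B : Set X} (h : A ⊆ B) (o : Ordinal.{v}) : cbDeriv A o ⊆ cbDeriv B o := by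
  induction o using WellFoundedLT.induction with
  | ind o ih =>
    intro x hx
    rw [mem_cbDeriv] at hx ⊢
    exact ⟨h hx.1, fun i hi => derivedSet_mono _ _ (ih i hi) (hx.2 i hi)⟩

theorem isClosed_cbDeriv [T1Space X] {A : Set X} (hA : IsClosed A) (o : Ordinal.{v}) :
    IsClosed (cbDeriv A o) := by
  rw [cbDeriv]
  exact hA.inter (isClosed_iInter fun i => isClosed_derivedSet _)

/-- If no level were empty, choosing an isolated point in each would inject all ordinals into `X`,
since such a point is lost at every later level. -/
theorem exists_cbDeriv_eq_empty (hX : IsScatteredSpace X) (A : Set X) :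
    ∃ o, cbDeriv A o = ∅ := by
  by_contra! h
  have h1 : ∀ o, ∃ x ∈ cbDeriv A o, x ∉ derivedSet (cbDeriv A o) := by
    intro o
    obtain ⟨x, hx, U, hU, hUx⟩ := hX _ (h o)
    refine ⟨x, hx, fun hacc => ?_⟩
    rw [mem_derivedSet, accPt_iff_nhds] at hacc
    have hxU : x ∈ U := (hUx.symm ▸ mem_singleton x : x ∈ U ∩ cbDeriv A o).1
    obtain ⟨y, hy, hne⟩ := hacc U (hU.mem_nhds hxU)
    rw [hUx] at hy
    exact hne hy
  choose f hf hf' using h1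
  refine not_injective_of_ordinal f fun a b hab => ?_
  by_contra hne
  rcases lt_or_gt_of_ne hne with hlt | hlt
  · exact hf' a (hab ▸ (mem_cbDeriv.1 (hf b)).2 a hlt)
  · exact hf' b (hab ▸ (mem_cbDeriv.1 (hf a)).2 b hlt)

theorem exists_cbDeriv_finite_nonempty [T2Space X] [CompactSpace X] (hX : IsScatteredSpace X)
    {A : Set X} (hA : IsClosed A) (hne : A.Nonempty) :
    ∃ o, (cbDeriv A o).Finite ∧ (cbDeriv A o).Nonempty := by
  have hex : {o | cbDeriv A o = ∅}.Nonempty := exists_cbDeriv_eq_empty hX A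
  set o := wellFounded_lt.min _ hex with ho
  have ho' : cbDeriv A o = ∅ := wellFounded_lt.min_mem _ hex
  have hmin : ∀ i < o, (cbDeriv A i).Nonempty := fun i hi =>
    nonempty_iff_ne_empty.2 fun h => wellFounded_lt.not_lt_min {o | cbDeriv A o = ∅} h hi
  -- By compactness the first empty level cannot arise as an intersection of nonempty derived sets,
  -- so an earlier level has no accumulation points and is finite.
  have : ∃ i < o, derivedSet (cbDeriv A i) = ∅ := by
    by_contra! hcon
    have hpos : Nonempty (Iio o) := by
      by_contra hemp
      rw [not_nonempty_iff] at hemp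
      rw [cbDeriv, iInter_of_empty, inter_univ] at ho'
      exact hne.ne_empty ho'
    have hsub : ∀ i, derivedSet (cbDeriv A i) ⊆ A := fun i =>
      ((isClosed_iff_derivedSet_subset _).1 (isClosed_cbDeriv hA i)).trans
        fun x hx => (mem_cbDeriv.1 hx).1
    have hne' := IsCompact.nonempty_iInter_of_directed_nonempty_isCompact_isClosed
      (fun i : Iio o => derivedSet (cbDeriv A i.1))
      (directed_of_isDirected_le fun i j hij => derivedSet_mono _ _ (cbDeriv_antitone A hij))
      (fun i => hcon i.1 i.2) (fun i => (isClosed_derivedSet _).isCompact)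
      fun i => isClosed_derivedSet _
    obtain ⟨x, hx⟩ := hne'
    have : x ∈ cbDeriv A o :=
      mem_cbDeriv.2 ⟨hsub _ (mem_iInter.1 hx hpos.some), fun i hi => mem_iInter.1 hx ⟨i, hi⟩⟩
    simp [ho'] at this
  obtain ⟨i, hi, hd⟩ := this
  refine ⟨i, ?_, hmin i hi⟩
  by_contra hinf
  obtain ⟨x, -, hx⟩ := Set.Infinite.exists_accPt_of_subset_isCompact hinf isCompact_univ
    (subset_univ _)
  exact (hd ▸ hx : x ∈ (∅ : Set X))

/-- If `D` is contained in the image under an injective closed embedding of its preimage under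
an open embedding, then so are its derivatives. -/
theorem cbDeriv_subset_image_preimage {F : Type w} [TopologicalSpace F] {k j : F → X}
    (hk : IsClosedEmbedding k) (hj : IsOpenEmbedding j) {D : Set X} (hD : D ⊆ k '' (j ⁻¹' D))
    (o : Ordinal.{v}) : cbDeriv D o ⊆ k '' (j ⁻¹' cbDeriv D o) := by
  induction o using WellFoundedLT.induction with
  | ind o ih =>
    intro x hx
    rw [mem_cbDeriv] at hx
    obtain ⟨z, hz, rfl⟩ := hD hx.1
    refine ⟨z, mem_cbDeriv.2 ⟨hz, fun i hi => ?_⟩, rfl⟩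
    have h1 := derivedSet_mono _ _ (ih i hi) (hx.2 i hi)
    rw [mem_derivedSet, accPt_iff_nhds] at h1 ⊢
    intro U hU
    have hjU : j ⁻¹' U ∈ 𝓝 z := hj.continuous.continuousAt hU
    rw [hk.isInducing.nhds_eq_comap, Filter.mem_comap] at hjU
    obtain ⟨W, hW, hWU⟩ := hjU
    obtain ⟨_, ⟨hyW, y, hy, rfl⟩, hne⟩ := h1 W hW
    exact ⟨j y, ⟨hWU hyW, hy⟩, fun h => hne (congrArg k (hj.injective h))⟩

/-- With `E` the finite derivative, `E ⊆ k '' (j ⁻¹' E)` gives `|E| ≤ |j ⁻¹' E|`, so the injective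
`j` maps `j ⁻¹' E` onto `E`. -/
theorem cbDeriv_subset_range {F : Type w} [TopologicalSpace F] {k j : F → X}
    (hk : IsClosedEmbedding k) (hj : IsOpenEmbedding j) {D : Set X} (hD : D ⊆ k '' (j ⁻¹' D))
    {o : Ordinal.{v}} (hfin : (cbDeriv D o).Finite) : cbDeriv D o ⊆ range j := by
  have h1 := cbDeriv_subset_image_preimage hk hj hD o
  set E := cbDeriv D o with hE
  have hfinj : (j ⁻¹' E).Finite := hfin.preimage hj.injective.injOn
  have h2 : E.ncard ≤ (j '' (j ⁻¹' E)).ncard := by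
    rw [ncard_image_of_injective _ hj.injective]
    exact (ncard_le_ncard h1 (hfinj.image k)).trans (ncard_image_le hfinj)
  have h3 := eq_of_subset_of_ncard_le (image_preimage_subset j E) h2 hfin
  rw [← h3]
  exact image_subset_range _ _

end CantorBendixson

/-! ### Destroying prescribed fan points by deleting isolated points. -/

section Destroy

open Order

variable {I : Type v} [LinearOrder I] {X : Type w} [TopologicalSpace X]

theorem IsFanBasis.restrict {J : I → Set X} {y : X} (hJ : IsFanBasis J y) {F : Set X} (hy : y ∈ F) :
    IsFanBasis (fun a => ((↑) : F → X) ⁻¹' J a) ⟨y, hy⟩ where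
  anti _ _ hab := preimage_mono (hJ.anti hab)
  mem_nhds a := continuous_subtype_val.continuousAt (hJ.mem_nhds a)
  exists_subset U hU := by
    rw [nhds_subtype_eq_comap, Filter.mem_comap] at hU
    obtain ⟨W, hW, hWU⟩ := hU
    obtain ⟨a, ha⟩ := hJ.exists_subset W hW
    exact ⟨a, (preimage_mono ha).trans hWU⟩
  isClosed a := (hJ.isClosed a).preimage continuous_subtype_val
  mem_of_limit a ha x hx := hJ.mem_of_limit a ha x hx

theorem isFanPt_coe_iff [RegularSpace X] {F N : Set X} (hN : IsOpen N) (hNF : N ⊆ F)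
    {x : F} (hx : x.1 ∈ N) {T : Set I} : IsFanPt T x ↔ IsFanPt T x.1 := by
  have h1 : IsOpenEmbedding (inclusion hNF) :=
    ⟨IsEmbedding.inclusion hNF, by
      rw [range_inclusion]; exact hN.preimage continuous_subtype_val⟩
  have h2 : IsOpenEmbedding ((↑) : N → X) := hN.isOpenEmbedding_subtypeVal
  exact (isFanPt_iff_of_isOpenEmbedding h1 (a := ⟨x.1, hx⟩)).trans
    (isFanPt_iff_of_isOpenEmbedding h2 (a := ⟨x.1, hx⟩)).symm

variable [WellFoundedLT I] [IsRegularCardinalOrder I]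

/-- Removing the isolated points near a fan point changes its trace to the empty set but does not
make it isolated. -/
theorem IsFanPt.isTracePt_empty [T1Space X] (hI : ℵ₀ < #I) {T : Set I} {y : X} (h : IsFanPt T y)
    (hT : IsStationary T) {F V : Set X} (hV : V ∈ 𝓝 y) (hy : y ∈ F)
    (hF : ∀ z ∈ V, z ∈ F ↔ ¬ IsOpen {z}) :
    IsTracePt (∅ : Set I) (⟨y, hy⟩ : F) ∧ ¬ IsOpen {(⟨y, hy⟩ : F)} := by
  obtain ⟨J, hJ, ⟨d, hd⟩, -⟩ := h
  obtain ⟨i, hi⟩ := hJ.exists_subset V hV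
  refine ⟨⟨_, hJ.restrict hy, max d i, fun a ha hda => ?_⟩, fun hopen => ?_⟩
  · simp only [mem_empty_iff_false, false_iff, not_not]
    obtain ⟨-, s, hs, hso, N, hN, hNi⟩ := hd a ha ((le_max_left _ _).trans_lt hda)
    have hJV : J a ⊆ V := (hJ.anti ((le_max_right _ _).trans hda.le)).trans hi
    set K : Set F := (↑) ⁻¹' J a with hK
    have hKcl : IsClosed K := (hJ.isClosed a).preimage continuous_subtype_val
    have hKo : IsOpen (((↑) : F → X) ⁻¹' (J a \ {s})) := hso.preimage continuous_subtype_val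
    -- Near `s`, the only points of `J a` other than `s` were isolated in `X`, hence are absent from
    -- `F`. Thus `interior K` is `K` with or without `s`, and both are closed.
    have hKcl' : IsClosed (((↑) : F → X) ⁻¹' (J a \ {s})) := by
      have : ((↑) : F → X) ⁻¹' (J a \ {s}) = K ∩ (↑) ⁻¹' (interior N)ᶜ := by
        ext z
        refine ⟨fun hz => ⟨hz.1, fun hzN => ?_⟩, fun hz => ⟨hz.1, ?_⟩⟩
        · exact (hF z.1 (hJV hz.1)).1 z.2 (hNi z.1 (interior_subset hzN) hz.1 hz.2)
        · rintro rfl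
          exact hz.2 (mem_interior_iff_mem_nhds.2 hN)
      rw [this]
      exact hKcl.inter (isOpen_interior.isClosed_compl.preimage continuous_subtype_val)
    have hsub : ((↑) : F → X) ⁻¹' (J a \ {s}) ⊆ interior K :=
      interior_maximal (preimage_mono sdiff_subset) hKo
    by_cases hsK : ∃ z ∈ interior K, z.1 = s
    · obtain ⟨z, hz, rfl⟩ := hsK
      have : interior K = K := by
        refine Subset.antisymm interior_subset fun x hx => ?_
        by_cases hxz : x = z
        · rwa [hxz]
        · exact hsub ⟨hx, fun h => hxz (Subtype.ext h)⟩
      rwa [this]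
    · have : interior K = ((↑) : F → X) ⁻¹' (J a \ {s}) :=
        Subset.antisymm (fun x hx => ⟨(interior_subset hx : x ∈ K), fun h => hsK ⟨x, hx, h⟩⟩) hsub
      rwa [this]
  · obtain ⟨W, hW, hWy⟩ := isOpen_induced_iff.1 hopen
    have hyW : y ∈ W := by
      have : (⟨y, hy⟩ : F) ∈ ((↑) : F → X) ⁻¹' W := by rw [hWy]; rfl
      exact this
    obtain ⟨c, hc⟩ := hJ.exists_subset W (hW.mem_nhds hyW)
    -- At a large limit `a ∈ T`, a boundary point `s` of `interior (J a)` is not isolated, so it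
    -- survives in `F`; it differs from `y`, which is interior to `J a`.
    obtain ⟨a, haT, hlim, hda, -⟩ := hT (isClub_closurePoints hI id (max (max d i) c))
    have hdi : max d i < a := (le_max_left _ _).trans_lt hda
    have hncl := (hd a hlim ((le_max_left _ _).trans_lt hdi)).1.1 haT
    rw [← closure_subset_iff_isClosed, not_subset] at hncl
    obtain ⟨s, hs, hs'⟩ := hncl
    have hsJ : s ∈ J a := closure_minimal interior_subset (hJ.isClosed a) hs
    have hsF : s ∈ F := by
      refine (hF s (hi (hJ.anti ((le_max_right _ _).trans hdi.le) hsJ))).2 fun hso => hs' ?_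
      obtain ⟨x, hx, hx'⟩ := mem_closure_iff.1 hs _ hso rfl
      rwa [← mem_singleton_iff.1 hx]
    have hsy : (⟨s, hsF⟩ : F) ∈ ((↑) : F → X) ⁻¹' W :=
      hc (hJ.anti ((le_max_right _ _).trans hda.le) hsJ)
    rw [hWy, mem_singleton_iff, Subtype.mk.injEq] at hsy
    rw [hsy] at hs'
    exact hs' (mem_interior_iff_mem_nhds.2 (hJ.mem_nhds a))

/-- In a monotonically normal space there is a closed set without any fan points of prescribed
stationary traces, in which the fan points of other traces survive. -/
theorem exists_isClosed_forall_not_isFanPt [T2Space X] [RegularSpace X] (hI : ℵ₀ < #I)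
    {G : X → Set X → Set X} (hG : IsMonotoneNormality G) {𝒜 : Set (Set I)}
    (h𝒜 : ∀ T ∈ 𝒜, IsStationary T) :
    ∃ F : Set X, IsClosed F ∧ (∀ T ∈ 𝒜, ∀ x : F, ¬ IsFanPt T x) ∧
      ∀ T : Set I, IsStationary T → ∀ y : X, IsFanPt T y → (∀ T' ∈ 𝒜, ¬ IsFanPt T' y) →
        ∃ hy : y ∈ F, IsFanPt T (⟨y, hy⟩ : F) := by
  set P : Set X := {y | ∃ T ∈ 𝒜, IsFanPt T y} with hP
  have hnotsmall : ∀ T, IsStationary T → ∀ y : X, IsFanPt T y → ∀ N ∈ 𝓝 y,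
      ¬ Cardinal.lift.{v} #N < Cardinal.lift.{w} #I :=
    fun T hT y hy N hN => hy.isTracePt.not_mk_lt hI hT hN
  have hU : ∀ y : X, ∃ U : Set X, y ∈ P → IsOpen U ∧ y ∈ U ∧ ∀ z ∈ U, z ≠ y →
      ∃ N ∈ 𝓝 z, Cardinal.lift.{v} #N < Cardinal.lift.{w} #I := by
    intro y
    by_cases hy : y ∈ P
    · obtain ⟨T, hT, hyT⟩ := hy
      obtain ⟨U, hU⟩ := hyT.exists_isOpen
      exact ⟨U, fun _ => hU⟩
    · exact ⟨∅, fun h => absurd h hy⟩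
  choose U hU using hU
  obtain ⟨V, hV, hVloc⟩ := hG.exists_expansion (P := P) (U := U) fun y hy =>
    ⟨(hU y hy).1, (hU y hy).2.1, fun z hz ⟨T, hT, hzT⟩ => by
      by_contra hne
      obtain ⟨N, hN, hc⟩ := (hU y hy).2.2 z hz hne
      exact hnotsmall T (h𝒜 T hT) z hzT N hN hc⟩
  -- Only isolated points inside the expansion `V` are deleted, which leaves the space unchanged
  -- near fan points outside `P`.
  set O : Set X := ⋃ y ∈ P, V y ∩ {z | IsOpen {z}} with hO
  have hIso : IsOpen {z : X | IsOpen {z}} := by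
    rw [isOpen_iff_forall_mem_open]
    exact fun z hz => ⟨{z}, singleton_subset_iff.2 hz, hz, rfl⟩
  have hOo : IsOpen O := isOpen_biUnion fun y hy => (hV y hy).1.inter hIso
  have hmemO : ∀ z, z ∈ O ↔ ∃ y ∈ P, z ∈ V y ∧ IsOpen {z} := fun z => by
    simp [hO, and_left_comm]
  have hPO : ∀ y ∈ P, y ∈ Oᶜ := by
    rintro y ⟨T, hT, hyT⟩ hyO
    obtain ⟨-, -, -, h⟩ := (hmemO y).1 hyO
    exact hyT.isTracePt.not_isOpen_singleton hI (h𝒜 T hT) h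
  have hPtrace : ∀ y (hy : y ∈ P), IsTracePt (∅ : Set I) (⟨y, hPO y hy⟩ : (Oᶜ : Set X)) ∧
      ¬ IsOpen {(⟨y, hPO y hy⟩ : (Oᶜ : Set X))} := by
    intro y hy
    obtain ⟨T, hT, hyT⟩ := hy
    have hy : y ∈ P := ⟨T, hT, hyT⟩
    refine hyT.isTracePt_empty hI (h𝒜 T hT) ((hV y hy).1.mem_nhds (hV y hy).2.1) (hPO y hy)
      fun z hz => ⟨fun hzO h => hzO ((hmemO z).2 ⟨y, hy, hz, h⟩), fun h hzO => ?_⟩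
    obtain ⟨-, -, -, h'⟩ := (hmemO z).1 hzO
    exact h h'
  have hlocal : ∀ x ∉ P, x ∉ closure P →
      (∀ N ∈ 𝓝 x, ¬ Cardinal.lift.{v} #N < Cardinal.lift.{w} #I) →
      ∃ N, IsOpen N ∧ x ∈ N ∧ N ⊆ Oᶜ := by
    intro x hxP hxcl hx
    have hxV : ∀ y ∈ P, x ∉ closure (V y) := by
      intro y hy hxy
      obtain ⟨N, hN, hc⟩ := (hU y hy).2.2 x ((hV y hy).2.2 hxy) fun h => hxP (h ▸ hy)
      exact hx N hN hc
    obtain ⟨N, hN, hN'⟩ := hVloc x hxcl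
    by_cases hex : ∃ y ∈ P, (N ∩ V y).Nonempty
    · obtain ⟨y, hy, hne⟩ := hex
      refine ⟨interior N ∩ (closure (V y))ᶜ, isOpen_interior.inter isClosed_closure.isOpen_compl,
        ⟨mem_interior_iff_mem_nhds.2 hN, hxV y hy⟩, fun z hz hzO => ?_⟩
      obtain ⟨y', hy', hzy', -⟩ := (hmemO z).1 hzO
      obtain rfl := hN' y hy y' hy' hne ⟨z, interior_subset hz.1, hzy'⟩
      exact hz.2 (subset_closure hzy')
    · refine ⟨interior N, isOpen_interior, mem_interior_iff_mem_nhds.2 hN, fun z hz hzO => ?_⟩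
      obtain ⟨y', hy', hzy', -⟩ := (hmemO z).1 hzO
      exact hex ⟨y', hy', z, interior_subset hz, hzy'⟩
  refine ⟨Oᶜ, hOo.isClosed_compl, fun T hT x hx => ?_, fun T hT y hy hy' => ?_⟩
  · by_cases hxP : x.1 ∈ P
    · refine hx.isTracePt.not_isStationary_diff hI (hPtrace x.1 hxP).1 ?_
      simpa using h𝒜 T hT
    -- If `P` accumulated at a fan point `x` of `F`, some nearby `y ∈ P` would have a small
    -- neighbourhood in `F` and so be isolated there, which the trace computation excludes.
    · have hxcl : x.1 ∉ closure P := by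
        intro hcl
        obtain ⟨V', hV'o, hxV', hV'⟩ := hx.exists_isOpen
        obtain ⟨W, hW, rfl⟩ := isOpen_induced_iff.1 hV'o
        obtain ⟨y, hyW, hyP⟩ := mem_closure_iff.1 hcl W hW hxV'
        obtain ⟨N, hN, hc⟩ := hV' ⟨y, hPO y hyP⟩ hyW fun h => hxP (h ▸ hyP)
        obtain ⟨⟨J, hJ, -⟩, hno⟩ := hPtrace y hyP
        exact hno (hJ.isOpen_singleton_of_mk_lt hN hc)
      obtain ⟨N, hNo, hxN, hNF⟩ := hlocal x.1 hxP hxcl fun N hN hc => by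
        refine hx.isTracePt.not_mk_lt hI (h𝒜 T hT)
          (N := ((↑) : (Oᶜ : Set X) → X) ⁻¹' N) (continuous_subtype_val.continuousAt hN) ?_
        refine lt_of_le_of_lt (Cardinal.lift_le.2 ?_) hc
        exact mk_preimage_of_injective _ _ Subtype.val_injective
      exact hxP ⟨T, hT, (isFanPt_coe_iff hNo hNF hxN).1 hx⟩
  · have hyP : y ∉ P := fun ⟨T', hT', h⟩ => hy' T' hT' h
    have hycl : y ∉ closure P := by
      intro hcl
      obtain ⟨V', hV'o, hyV', hV'⟩ := hy.exists_isOpen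
      obtain ⟨z, hzV', hzP⟩ := mem_closure_iff.1 hcl V' hV'o hyV'
      obtain ⟨N, hN, hc⟩ := hV' z hzV' fun h => hyP (h ▸ hzP)
      obtain ⟨T', hT', hzT'⟩ := hzP
      exact hnotsmall T' (h𝒜 T' hT') z hzT' N hN hc
    obtain ⟨N, hNo, hyN, hNF⟩ := hlocal y hyP hycl (hnotsmall T hT y hy)
    exact ⟨hNF hyN, (isFanPt_coe_iff (x := ⟨y, hNF hyN⟩) hNo hNF hyN).2 hy⟩

end Destroy

/-! ### Minimal accumulation sets and the contradiction with the CO property. -/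

section Main

variable {I : Type v} [LinearOrder I] {X : Type w} [TopologicalSpace X]

/-- The points of `X` that are fan points with trace among the `T n`, `n ∈ M`. -/
def fanPts (X : Type w) [TopologicalSpace X] (T : ℕ → Set I) (M : Set ℕ) : Set X :=
  {y | ∃ n ∈ M, IsFanPt (T n) y}

theorem fanPts_mono (T : ℕ → Set I) {M N : Set ℕ} (h : M ⊆ N) : fanPts X T M ⊆ fanPts X T N :=
  fun _ ⟨n, hn, hy⟩ => ⟨n, h hn, hy⟩

theorem exists_disjoint_infinite_subsets {M : Set ℕ} (hM : M.Infinite) :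
    ∃ M₁ ⊆ M, ∃ M₂ ⊆ M, M₁.Infinite ∧ M₂.Infinite ∧ Disjoint M₁ M₂ := by
  let e := Nat.nth (· ∈ M)
  have he : Function.Injective e := Nat.nth_injective hM
  have heM : ∀ n, e n ∈ M := Nat.nth_mem_of_infinite hM
  refine ⟨range fun n => e (2 * n), by rintro _ ⟨n, rfl⟩; exact heM _,
    range fun n => e (2 * n + 1), by rintro _ ⟨n, rfl⟩; exact heM _,
    infinite_range_of_injective fun a b h => ?_, infinite_range_of_injective fun a b h => ?_, ?_⟩
  · have := he h; omega
  · have := he h; omega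
  · rw [disjoint_left]
    rintro _ ⟨m, rfl⟩ ⟨n, hn⟩
    have := he hn
    omega

variable [WellFoundedLT I] [IsRegularCardinalOrder I]

/-- A compact scattered monotonically normal CO space does not have fan points of infinitely many
different stationary traces. -/
theorem IsCOSpace.false_of_isFanPt [T2Space X] [CompactSpace X] (hI : ℵ₀ < #I)
    (hX : IsScatteredSpace X) (hCO : IsCOSpace X) {G : X → Set X → Set X}
    (hG : IsMonotoneNormality G) {T : ℕ → Set I} (hT : ∀ n, IsStationary (T n))
    (hTd : ∀ m n, m < n → IsStationary (T m \ T n)) (hP : ∀ n, ∃ y : X, IsFanPt (T n) y) :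
    False := by
  have huniq : ∀ m n (y : X), IsFanPt (T m) y → IsFanPt (T n) y → m = n := by
    intro m n y hm hn
    rcases lt_trichotomy m n with h | h | h
    · exact absurd (hTd m n h) (hm.isTracePt.not_isStationary_diff hI hn.isTracePt)
    · exact h
    · exact absurd (hTd n m h) (hn.isTracePt.not_isStationary_diff hI hm.isTracePt)
  choose p hp using hP
  have hpinj : Function.Injective p := fun m n h => huniq m n (p m) (hp m) (h ▸ hp n)
  let D : Set ℕ → Set X := fun M => derivedSet (fanPts X T M)
  have hDmono : ∀ {M N : Set ℕ}, M ⊆ N → D M ⊆ D N := fun h => derivedSet_mono _ _ (fanPts_mono T h)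
  have hDcl : ∀ M, IsClosed (D M) := fun M => isClosed_derivedSet _
  have hDne : ∀ M : Set ℕ, M.Infinite → (D M).Nonempty := by
    intro M hM
    have hinf : (fanPts X T M).Infinite :=
      (hM.image hpinj.injOn).mono (by rintro _ ⟨n, hn, rfl⟩; exact ⟨n, hn, hp n⟩)
    obtain ⟨x, -, hx⟩ := hinf.exists_accPt_of_subset_isCompact isCompact_univ (subset_univ _)
    exact ⟨x, hx⟩
  -- minimise the rank of the accumulation sets, then the number of their points of maximal rank
  have hex : {o | ∃ M : Set ℕ, M.Infinite ∧ (cbDeriv (D M) o).Finite}.Nonempty := by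
    obtain ⟨o, ho, -⟩ := exists_cbDeriv_finite_nonempty hX (hDcl Set.univ)
      (hDne Set.univ infinite_univ)
    exact ⟨o, Set.univ, infinite_univ, ho⟩
  obtain ⟨o, ⟨M₀, hM₀, hfin₀⟩, homin⟩ : ∃ o, (∃ M : Set ℕ, M.Infinite ∧ (cbDeriv (D M) o).Finite) ∧
      ∀ o', (∃ M : Set ℕ, M.Infinite ∧ (cbDeriv (D M) o').Finite) → o ≤ o' :=
    ⟨wellFounded_lt.min _ hex, wellFounded_lt.min_mem _ hex,
      fun o' ho' => not_lt.1 (wellFounded_lt.not_lt_min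
        {o | ∃ M : Set ℕ, M.Infinite ∧ (cbDeriv (D M) o).Finite} ho')⟩
  have hne : ∀ M : Set ℕ, M.Infinite → (cbDeriv (D M) o).Nonempty := by
    intro M hM
    obtain ⟨o', hfin, hne⟩ := exists_cbDeriv_finite_nonempty hX (hDcl M) (hDne M hM)
    exact hne.mono (cbDeriv_antitone _ (homin o' ⟨M, hM, hfin⟩))
  have hfin : ∀ M ⊆ M₀, (cbDeriv (D M) o).Finite := fun M hM =>
    hfin₀.subset (cbDeriv_mono (hDmono hM) o)
  obtain ⟨M, ⟨hMM₀, hM⟩, hMmin⟩ : ∃ M : Set ℕ, (M ⊆ M₀ ∧ M.Infinite) ∧ ∀ N : Set ℕ,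
      N ⊆ M₀ → N.Infinite → (cbDeriv (D M) o).ncard ≤ (cbDeriv (D N) o).ncard := by
    have hex : {M : Set ℕ | M ⊆ M₀ ∧ M.Infinite}.Nonempty := ⟨M₀, Subset.rfl, hM₀⟩
    let f : Set ℕ → ℕ := fun M => (cbDeriv (D M) o).ncard
    exact ⟨Function.argminOn f _ hex, Function.argminOn_mem f _ hex,
      fun N h1 h2 => Function.argminOn_le f _ (⟨h1, h2⟩ : N ∈ {M : Set ℕ | M ⊆ M₀ ∧ M.Infinite})⟩
  -- Passing to an infinite subset can only shrink the finite level `o`, and minimality of its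
  -- cardinality forbids this.
  have hEeq : ∀ N ⊆ M, N.Infinite → cbDeriv (D N) o = cbDeriv (D M) o := fun N hN hNinf =>
    eq_of_subset_of_ncard_le (cbDeriv_mono (hDmono hN) o) (hMmin N (hN.trans hMM₀) hNinf)
      (hfin M hMM₀)
  obtain ⟨M₁, hM₁, M₂, hM₂, hinf₁, hinf₂, hdisj⟩ := exists_disjoint_infinite_subsets hM
  obtain ⟨F, hFcl, hF₁, hF₂⟩ := exists_isClosed_forall_not_isFanPt hI hG (𝒜 := T '' M₁)
    (by rintro _ ⟨n, -, rfl⟩; exact hT n)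
  obtain ⟨U, hU, ⟨h⟩⟩ := hCO F hFcl
  have hk : IsClosedEmbedding ((↑) : F → X) := hFcl.isClosedEmbedding_subtypeVal
  have hj : IsOpenEmbedding fun z : F => (h z : X) :=
    hU.isOpen.isOpenEmbedding_subtypeVal.comp h.isOpenEmbedding
  have hsurv : ∀ y ∈ fanPts X T M₂, ∃ hy : y ∈ F, (h ⟨y, hy⟩ : X) ∈ fanPts X T M₂ := by
    rintro y ⟨n, hn, hy⟩
    obtain ⟨hyF, hfan⟩ := hF₂ (T n) (hT n) y hy (by
      rintro _ ⟨m, hm, rfl⟩ hy'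
      obtain rfl := huniq m n y hy' hy
      exact disjoint_left.1 hdisj hm hn)
    exact ⟨hyF, n, hn, (isFanPt_iff_of_isOpenEmbedding hj).2 hfan⟩
  -- Surviving fan points go to fan points of the same trace in `X`, because `U` is open; hence `h`
  -- maps accumulation points of such points to accumulation points of such points.
  have hD : D M₂ ⊆ (↑) '' ((fun z : F => (h z : X)) ⁻¹' D M₂) := by
    intro d hd
    have hdF : d ∈ F := by
      have h1 : d ∈ closure (fanPts X T M₂) := derivedSet_subset_closure _ hd
      exact closure_minimal (fun y hy => (hsurv y hy).1) hFcl h1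
    refine ⟨⟨d, hdF⟩, ?_, rfl⟩
    have hd' : AccPt d _ := hd
    change AccPt (h ⟨d, hdF⟩ : X) _
    rw [accPt_iff_nhds] at hd' ⊢
    intro N hN
    have hN' := hj.continuous.continuousAt (x := ⟨d, hdF⟩) hN
    rw [Filter.mem_map, nhds_subtype_eq_comap, Filter.mem_comap] at hN'
    obtain ⟨W, hW, hWN⟩ := hN'
    obtain ⟨y, ⟨hyW, hy⟩, hne⟩ := hd' W hW
    obtain ⟨hyF, hy'⟩ := hsurv y hy
    refine ⟨_, ⟨hWN (show (⟨y, hyF⟩ : F) ∈ _ from hyW), hy'⟩, fun heq => hne ?_⟩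
    exact congrArg Subtype.val (hj.injective heq)
  have hrange := cbDeriv_subset_range hk hj hD (hfin M₂ (hM₂.trans hMM₀))
  obtain ⟨d, hd⟩ := hne M₂ hinf₂
  have hd₁ : d ∈ D M₁ := by
    rw [hEeq M₂ hM₂ hinf₂, ← hEeq M₁ hM₁ hinf₁] at hd
    exact (mem_cbDeriv.1 hd).1
  have hd₁' : AccPt d _ := hd₁
  rw [accPt_iff_nhds] at hd₁'
  obtain ⟨_, ⟨⟨z, rfl⟩, n, hn, hz⟩, -⟩ := hd₁' _ (hj.isOpen_range.mem_nhds (hrange hd))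
  exact hF₁ (T n) ⟨n, hn, rfl⟩ z ((isFanPt_iff_of_isOpenEmbedding hj).1 hz)

end Main

end COSpaces

theorem proposition5p2 :
    (∀ lam : Cardinal.{u}, lam.IsRegular → Cardinal.aleph0 < lam →
      ∀ S₁ S₂ : Set (Set.Iio lam.ord), IsStationary (S₁ \ S₂) →
        IsEmpty (COSpaces.SumSpace S₁ ≃ₜ COSpaces.SumSpace S₂) ∧
        ∀ α : Ordinal.{t}, IsEmpty (COSpaces.SumSpace S₁ ≃ₜ Set.Iio α)) ∧
    (∀ (X : Type v) [TopologicalSpace X] [T2Space X],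
      COSpaces.IsScatteredSpace X →
      COSpaces.IsImageOfCompactIntervalSpace.{v, w} X →
      COSpaces.IsCOSpace X →
      ∀ lam : Cardinal.{u}, lam.IsRegular → Cardinal.aleph0 < lam →
      ∀ (S : Set (Set.Iio lam.ord)) (mu : S → Cardinal.{u}),
        (∀ a : S, (mu a).IsRegular ∧ Cardinal.aleph0 < mu a) →
        IsStationary S →
        ¬ ∃ f : COSpaces.ObstructionSpace mu → X, Topology.IsEmbedding f) := by
  refine ⟨fun lam hreg hlam S₁ S₂ hS => ⟨COSpaces.isEmpty_homeomorph_sumSpace hreg hlam hS,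
    COSpaces.isEmpty_homeomorph_ordinal hreg hlam (hS.mono Set.sdiff_subset)⟩, ?_⟩
  rintro X _ _ hX himg hCO lam hreg hlam S mu - hS ⟨f, hf⟩
  have := COSpaces.isRegularCardinalOrder_Iio_ord hreg
  have hI := COSpaces.aleph0_lt_mk_Iio_ord hlam
  obtain ⟨_, G, hG⟩ := himg.exists_isMonotoneNormality
  obtain ⟨T, hTS, hT, hTd⟩ := COSpaces.exists_stationary_sequence hI hS
  refine hCO.false_of_isFanPt hI hX hG hT hTd fun n => ?_
  have := COSpaces.compactSpace_sumSpace (S := T n) hlam.le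
  -- A continuous injection of a compact space into a Hausdorff one is a closed embedding. The CO
  -- property then replaces the closed image by a clopen one, along which fan points transfer.
  have hg : Topology.IsClosedEmbedding (f ∘ COSpaces.toObstruction mu (hTS n)) :=
    (hf.continuous.comp (COSpaces.continuous_toObstruction hlam.le (hTS n))).isClosedEmbedding
      (hf.injective.comp (COSpaces.toObstruction_injective (hTS n)))
  obtain ⟨U, hU, ⟨h⟩⟩ := hCO _ hg.isClosed_range
  have hj : Topology.IsOpenEmbedding fun x => (h (hg.isEmbedding.toHomeomorph x) : X) :=
    hU.isOpen.isOpenEmbedding_subtypeVal.comp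
      (h.isOpenEmbedding.comp hg.isEmbedding.toHomeomorph.isOpenEmbedding)
  exact ⟨_, (COSpaces.isFanPt_iff_of_isOpenEmbedding hj).2 (COSpaces.isFanPt_top hreg hlam)⟩
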